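/- Let $d>1$ be odd, let $0\le r_0<r_1\le\infty$, $r_0<\infty$, and let $A(r_0,r_1)=\{x\in\mathbb{R}^d: r_0<|x|<r_1\}$. Let $\tau\ge 0$ satisfy $\tau<1/(2r_0)$ (with $1/0=\infty$ throughout), and let $f:A(r_0,r_1)\to\mathbb{C}$ be polyharmonic of infinite order and type $\tau$, i.e. $f$ is $C^\infty$ and for every compact $K\subset A(r_0,r_1)$ and every $\varepsilon>0$ there is a constant $C_{K,\varepsilon}>0$ such that $\max_{x\in K}|\Delta^p f(x)|\le C_{K,\varepsilon}\,(2p)!\,(\tau+\varepsilon)^{2p}$ for all $p\in\mathbb{N}_0$. For each $k\in\mathbb{N}_0$ let $Y_{k,l}$, $l=1,\dots,a_k$, be a basis of the space of harmonic homogeneous polynomials of degree $k$ on $\mathbb{R}^d$ that is orthonormal with respect to $\langle g,h\rangle=\int_{\mathbb{S}^{d-1}}g(\theta)\overline{h(\theta)}\,d\theta$, where $d\theta$ is the rotation invariant surface measure on $\mathbb{S}^{d-1}$, and let $$f_{k,l}(r)=\int_{\mathbb{S}^{d-1}}f(r\theta)\overline{Y_{k,l}(\theta)}\,d\theta,\qquad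 r_0<r<r_1,$$ be the Fourier--Laplace coefficients of $f$. Then for each $k\in\mathbb{N}_0$ and $l=1,\dots,a_k$ there exist complex numbers $a_{k,l,j}$, $j\in\mathbb{N}_0$, such that the series $$F_{k,l}(z)=z^k\sum_{j=0}^\infty a_{k,l,2j}z^{2j}+z^{-k-d+2}\sum_{j=0}^\infty a_{k,l,2j+1}z^{2j}$$ converges absolutely, and uniformly on compact subsets, in the annulus $\{z\in\mathbb{C}:0<|z|<1/(2\tau)\}$, its sum $F_{k,l}$ is analytic there, and $F_{k,l}(r)=f_{k,l}(r)$ for all $r$ with $r_0<r<\min\{r_1,1/(2\tau)\}$. Moreover, the power series $\sum_{j}a_{k,l,2j}z^{2j}$ and $\sum_{j}a_{k,l,2j+1}z^{2j}$ have radius of convergence at least $1/(2\tau)$; in particular, their sums are entire functions if $\tau=0$. -/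

import Mathlib

open MeasureTheory Laplacian
open scoped NNReal ENNReal ContDiff ComplexConjugate

noncomputable section

/-- The open annular region `{x : r₀ < |x| < r₁}`, where `0 ≤ r₀` and `r₁ ≤ ∞`. -/
def annulus (E : Type*) [NormedAddCommGroup E] (r₀ r₁ : ℝ≥0∞) : Set E :=
  {x | r₀ < ‖x‖ₑ ∧ ‖x‖ₑ < r₁}

/-- `f` is polyharmonic of infinite order and type `τ` on `G` (used for open `G`, so that the
iterated Laplacians on `G` depend only on the restriction of `f` to `G`). -/
def IsPolyharmonicInfiniteOrder {d : ℕ} (G : Set (EuclideanSpace ℝ (Fin d))) (τ : ℝ)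
    (f : EuclideanSpace ℝ (Fin d) → ℂ) : Prop :=
  ContDiffOn ℝ ∞ f G ∧
    ∀ K : Set (EuclideanSpace ℝ (Fin d)), IsCompact K → K ⊆ G → ∀ ε : ℝ, 0 < ε →
      ∃ C : ℝ, 0 < C ∧ ∀ p : ℕ, ∀ x ∈ K,
        ‖((fun g : EuclideanSpace ℝ (Fin d) → ℂ => Δ g)^[p] f) x‖ ≤
          C * (Nat.factorial (2 * p) : ℝ) * (τ + ε) ^ (2 * p)

/-- The Laplacian on polynomials in `d` variables. -/
def polyLaplacian (d : ℕ) : MvPolynomial (Fin d) ℂ →ₗ[ℂ] MvPolynomial (Fin d) ℂ :=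
  ∑ i : Fin d, (MvPolynomial.pderiv i).toLinearMap ∘ₗ (MvPolynomial.pderiv i).toLinearMap

/-- The space of harmonic homogeneous polynomials of degree `k` in `d` variables. -/
def harmonicHomogeneous (d k : ℕ) : Submodule ℂ (MvPolynomial (Fin d) ℂ) :=
  MvPolynomial.homogeneousSubmodule (Fin d) ℂ k ⊓ LinearMap.ker (polyLaplacian d)

/-- The dimension `a_k` of the space of harmonic homogeneous polynomials of degree `k`. -/
def harmonicDim (d k : ℕ) : ℕ := Module.finrank ℂ (harmonicHomogeneous d k)

/-- The value of a polynomial at a point of `ℝ^d`. -/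
def evalReal {d : ℕ} (P : MvPolynomial (Fin d) ℂ) (x : EuclideanSpace ℝ (Fin d)) : ℂ :=
  MvPolynomial.eval (fun i => ((x i : ℝ) : ℂ)) P

/-- The rotation invariant surface measure `dθ` on the unit sphere of `ℝ^d`. -/
abbrev surfaceMeasure (d : ℕ) :
    Measure (Metric.sphere (0 : EuclideanSpace ℝ (Fin d)) 1) :=
  (volume : Measure (EuclideanSpace ℝ (Fin d))).toSphere

/-- The family `Y` consists, for each `k`, of a basis of the harmonic homogeneous polynomials of
degree `k` that is orthonormal for the scalar product `∫ g(θ) conj(h(θ)) dθ` of the unit sphere. -/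
def IsSphereOrthonormal {d : ℕ}
    (Y : ∀ k : ℕ, Module.Basis (Fin (harmonicDim d k)) ℂ (harmonicHomogeneous d k)) : Prop :=
  ∀ (k : ℕ) (l m : Fin (harmonicDim d k)),
    ∫ θ, evalReal (Y k l : MvPolynomial (Fin d) ℂ) θ.1 *
        conj (evalReal (Y k m : MvPolynomial (Fin d) ℂ) θ.1) ∂(surfaceMeasure d) =
      if l = m then 1 else 0

/-- The Fourier-Laplace coefficient `r ↦ ∫ f(rθ) conj(P(θ)) dθ` of `f` with respect to `P`. -/
def fourierLaplaceCoeff {d : ℕ} (f : EuclideanSpace ℝ (Fin d) → ℂ)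
    (P : MvPolynomial (Fin d) ℂ) (r : ℝ) : ℂ :=
  ∫ θ, f (r • θ.1) * conj (evalReal P θ.1) ∂(surfaceMeasure d)

/-- The exponents `λ_{2j}(k) = k + 2j` and `λ_{2j+1}(k) = -k - d + 2 + 2j`. -/
def expo (d k n : ℕ) : ℤ :=
  if Even n then (k : ℤ) + 2 * (n / 2 : ℕ) else -(k : ℤ) - d + 2 + 2 * (n / 2 : ℕ)

/-- The function `∑_j a_{2j} z^{2j}`. -/
def evenPart (a : ℕ → ℂ) (z : ℂ) : ℂ := ∑' j : ℕ, a (2 * j) * z ^ (2 * j)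

/-- The function `∑_j a_{2j+1} z^{2j}`. -/
def oddPart (a : ℕ → ℂ) (z : ℂ) : ℂ := ∑' j : ℕ, a (2 * j + 1) * z ^ (2 * j)

/-- The function `z^k ∑_j a_{2j} z^{2j} + z^{-k-d+2} ∑_j a_{2j+1} z^{2j}`. -/
def laurentExtension (d k : ℕ) (a : ℕ → ℂ) (z : ℂ) : ℂ :=
  z ^ k * evenPart a z + z ^ (-(k : ℤ) - d + 2) * oddPart a z

/-- The formal power series `∑_j a_{2j} z^{2j}`. -/
def evenSeries (a : ℕ → ℂ) : FormalMultilinearSeries ℂ ℂ ℂ :=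
  FormalMultilinearSeries.ofScalars ℂ (fun n => if Even n then a n else 0)

/-- The formal power series `∑_j a_{2j+1} z^{2j}`. -/
def oddSeries (a : ℕ → ℂ) : FormalMultilinearSeries ℂ ℂ ℂ :=
  FormalMultilinearSeries.ofScalars ℂ (fun n => if Even n then a (n + 1) else 0)

end

/-!
Integrating `Δ^p f` against a solid harmonic `Q` of degree `k` over the sphere of radius `r` gives
a function `g_p`. Because the Laplace-Beltrami operator is symmetric and the restriction of `Q` is
one of its eigenfunctions, `g_{p+1} = g_p'' + (d - 1) / r * g_p' - k (k + d - 2) / r^2 * g_p`. In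
terms of `y_p = r^(k+d-2) g_p` this reads `y_{p+1} = y_p'' - (2n / r) y_p'`, where
`n = k + (d - 3) / 2` is an integer since `d` is odd.

The substitution `y ↦ y' / r` turns such a chain of order `n` into one of order `n - 1`. By
Landau's inequality, which bounds the first derivative by the function and its second derivative,
it preserves the growth `(2p)! (τ + ε)^(2p)`. After `n` steps the chain consists of the even
derivatives of a single function, whose Taylor series at any point `ρ < 1 / (2τ)` then has radius
of convergence at least `1 / τ`; recentring it at `0` leaves a power series convergent below
`1 / (2τ)`. Integrating `n` times recovers `y_0` as `r^(2n+1)` times an even power series plus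
another even power series.
-/

open Set Filter Topology
open scoped Nat

section TaylorSeries

variable {F : Type*} [NormedAddCommGroup F] [NormedSpace ℝ F]

lemma hasDerivAt_sum_taylor {u : ℕ → ℝ → F} {t : ℝ}
    (hu : ∀ m, HasDerivAt (u m) (u (m + 1) t) t) (r : ℝ) (N : ℕ) :
    HasDerivAt (fun s => ∑ m ∈ Finset.range (N + 1), ((r - s) ^ m / m !) • u m s)
      (((r - t) ^ N / N !) • u (N + 1) t) t := by
  induction N with
  | zero => simpa using hu 0
  | succ N ih =>
    have hcoeff : HasDerivAt (fun s : ℝ => (r - s) ^ (N + 1) / (N + 1)!)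
        (-((r - t) ^ N / N !)) t := by
      refine ((((hasDerivAt_id t).const_sub r).pow (N + 1)).div_const _).congr_deriv ?_
      rw [Nat.factorial_succ]
      push_cast
      field_simp
      simp
    simp_rw [Finset.sum_range_succ _ (N + 1)]
    refine (ih.add (hcoeff.smul (hu (N + 1)))).congr_deriv ?_
    module

lemma norm_sub_sum_taylor_le {u : ℕ → ℝ → F} {ρ r C T : ℝ}
    (hu : ∀ m, ∀ t ∈ uIcc ρ r, HasDerivAt (u m) (u (m + 1) t) t)
    (hbound : ∀ m, ∀ t ∈ uIcc ρ r, ‖u m t‖ ≤ C * m ! * T ^ m) (N : ℕ) :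
    ‖u 0 r - ∑ m ∈ Finset.range (N + 1), ((r - ρ) ^ m / m !) • u m ρ‖ ≤
      C * (((N + 1 : ℕ) : ℝ) * (T * |r - ρ|) ^ (N + 1)) := by
  have hend : ∑ m ∈ Finset.range (N + 1), ((r - r) ^ m / m !) • u m r = u 0 r := by
    simp [Finset.sum_range_succ']
  have hderiv : ∀ t ∈ uIcc ρ r, ‖((r - t) ^ N / N !) • u (N + 1) t‖ ≤
      C * ((N + 1 : ℕ) * (T ^ (N + 1) * |r - ρ| ^ N)) := fun t ht => by
    have hle : |r - t| ≤ |r - ρ| := by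
      simpa [abs_sub_comm] using abs_sub_right_of_mem_uIcc ht
    calc ‖((r - t) ^ N / N !) • u (N + 1) t‖
        = |r - t| ^ N / N ! * ‖u (N + 1) t‖ := by simp [norm_smul]
      _ ≤ |r - ρ| ^ N / N ! * (C * (N + 1)! * T ^ (N + 1)) := by
          gcongr
          exact hbound _ t ht
      _ = C * ((N + 1 : ℕ) * (T ^ (N + 1) * |r - ρ| ^ N)) := by
          rw [Nat.factorial_succ]
          push_cast
          field_simp
  have hmean := (convex_uIcc ρ r).norm_image_sub_le_of_norm_hasDerivWithin_le
    (fun t ht => (hasDerivAt_sum_taylor (fun m => hu m t ht) r N).hasDerivWithinAt) hderiv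
    left_mem_uIcc right_mem_uIcc
  rw [hend, Real.norm_eq_abs] at hmean
  refine hmean.trans_eq ?_
  ring

lemma hasSum_taylor_of_norm_le {u : ℕ → ℝ → F} {ρ r C T : ℝ} (hT : 0 ≤ T)
    (hTr : T * |r - ρ| < 1)
    (hu : ∀ m, ∀ t ∈ uIcc ρ r, HasDerivAt (u m) (u (m + 1) t) t)
    (hbound : ∀ m, ∀ t ∈ uIcc ρ r, ‖u m t‖ ≤ C * m ! * T ^ m) :
    HasSum (fun m => ((r - ρ) ^ m / m !) • u m ρ) (u 0 r) := by
  have hq : 0 ≤ T * |r - ρ| := by positivity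
  have hnorm : Summable fun m => ‖((r - ρ) ^ m / m !) • u m ρ‖ := by
    refine .of_nonneg_of_le (fun _ => norm_nonneg _) (fun m => ?_)
      ((summable_geometric_of_lt_one hq hTr).mul_left C)
    calc ‖((r - ρ) ^ m / m !) • u m ρ‖ = |r - ρ| ^ m / m ! * ‖u m ρ‖ := by simp [norm_smul]
      _ ≤ |r - ρ| ^ m / m ! * (C * m ! * T ^ m) := by
          gcongr
          exact hbound m ρ left_mem_uIcc
      _ = C * (T * |r - ρ|) ^ m := by
          field_simp
          ring
  have hlim : Tendsto (fun N => C * (((N + 1 : ℕ) : ℝ) * (T * |r - ρ|) ^ (N + 1))) atTop (𝓝 0) := by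
    simpa using ((tendsto_self_mul_const_pow_of_lt_one hq hTr).comp
      (tendsto_add_atTop_nat 1)).const_mul C
  refine (hasSum_iff_tendsto_nat_of_summable_norm hnorm).2 ((tendsto_add_atTop_iff_nat 1).1 ?_)
  refine tendsto_iff_norm_sub_tendsto_zero.2
    (squeeze_zero (fun _ => norm_nonneg _) (fun N => ?_) hlim)
  rw [norm_sub_rev]
  exact norm_sub_sum_taylor_le hu hbound N

end TaylorSeries

section GrowthType

/-- The interval of real radii `r` with `r₀ < r < r₁`. -/
def radii (r₀ r₁ : ℝ≥0∞) : Set ℝ := {r | r₀ < ENNReal.ofReal r ∧ ENNReal.ofReal r < r₁}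

lemma isOpen_radii (r₀ r₁ : ℝ≥0∞) : IsOpen (radii r₀ r₁) :=
  isOpen_Ioo.preimage ENNReal.continuous_ofReal

lemma ordConnected_radii (r₀ r₁ : ℝ≥0∞) : (radii r₀ r₁).OrdConnected :=
  ordConnected_Ioo.preimage_mono ENNReal.ofReal_mono

lemma pos_of_mem_radii {r₀ r₁ : ℝ≥0∞} {r : ℝ} (hr : r ∈ radii r₀ r₁) : 0 < r :=
  ENNReal.ofReal_pos.1 (bot_le.trans_lt hr.1)

/-- The sequence `y` of functions on `I` grows at most like `(2p)! (τ + ε)^(2p)`, for each `ε > 0`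
and uniformly on compact subintervals of `I`: the one-dimensional counterpart of being polyharmonic
of infinite order and type `τ`. -/
def HasGrowthType (I : Set ℝ) (τ : ℝ≥0) (y : ℕ → ℝ → ℂ) : Prop :=
  ∀ a b : ℝ, Icc a b ⊆ I → ∀ ε : ℝ, 0 < ε → ∃ C : ℝ, 0 ≤ C ∧ ∀ p : ℕ, ∀ r ∈ Icc a b,
    ‖y p r‖ ≤ C * (2 * p)! * (τ + ε) ^ (2 * p)

lemma exists_forall_sq_mul_pow_le {s t : ℝ} (hs : 0 ≤ s) (hst : s < t) :
    ∃ B : ℝ, 0 ≤ B ∧ ∀ n : ℕ, (n : ℝ) ^ 2 * s ^ n ≤ B * t ^ n := by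
  have ht : 0 < t := hs.trans_lt hst
  have hlim := tendsto_pow_const_mul_const_pow_of_abs_lt_one 2 (r := s / t)
    (by rwa [abs_of_nonneg (by positivity), div_lt_one ht])
  obtain ⟨B, hB⟩ := hlim.bddAbove_range
  have hB' (n : ℕ) : (n : ℝ) ^ 2 * (s / t) ^ n ≤ B := hB ⟨n, rfl⟩
  refine ⟨B, by simpa using hB' 0, fun n => ?_⟩
  have := hB' n
  rwa [div_pow, ← mul_div_assoc, div_le_iff₀ (by positivity)] at this

lemma HasGrowthType.shift {I : Set ℝ} {τ : ℝ≥0} {y : ℕ → ℝ → ℂ} (hy : HasGrowthType I τ y) :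
    HasGrowthType I τ (fun p => y (p + 1)) := by
  intro a b hab ε hε
  obtain ⟨C, hC, hyC⟩ := hy a b hab (ε / 2) (by positivity)
  obtain ⟨B, hB, hsq⟩ := exists_forall_sq_mul_pow_le (s := τ + ε / 2) (t := τ + ε)
    (by positivity) (by linarith)
  refine ⟨C * B * (τ + ε) ^ 2, by positivity, fun p r hr => (hyC (p + 1) r hr).trans ?_⟩
  have hfact : ((2 * (p + 1))! : ℝ) ≤ ((2 * (p + 1) : ℕ) : ℝ) ^ 2 * (2 * p)! := by
    rw [show 2 * (p + 1) = 2 * p + 1 + 1 by ring, Nat.factorial_succ, Nat.factorial_succ,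
      ← mul_assoc, sq]
    push_cast
    gcongr
    linarith
  calc C * (2 * (p + 1))! * (τ + ε / 2) ^ (2 * (p + 1))
      ≤ C * (((2 * (p + 1) : ℕ) : ℝ) ^ 2 * (2 * p)!) * (τ + ε / 2) ^ (2 * (p + 1)) := by gcongr
    _ = C * (2 * p)! * (((2 * (p + 1) : ℕ) : ℝ) ^ 2 * (τ + ε / 2) ^ (2 * (p + 1))) := by ring
    _ ≤ C * (2 * p)! * (B * (τ + ε) ^ (2 * (p + 1))) := by
        exact mul_le_mul_of_nonneg_left (hsq _) (by positivity)
    _ = C * B * (τ + ε) ^ 2 * (2 * p)! * (τ + ε) ^ (2 * p) := by ring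

lemma HasGrowthType.continuousOn_mul {I : Set ℝ} {τ : ℝ≥0} {y : ℕ → ℝ → ℂ}
    (hy : HasGrowthType I τ y) {w : ℝ → ℂ} (hw : ContinuousOn w I) :
    HasGrowthType I τ (fun p r => w r * y p r) := by
  intro a b hab ε hε
  obtain ⟨C, hC, hyC⟩ := hy a b hab ε hε
  obtain ⟨D, hD⟩ := isCompact_Icc.exists_bound_of_continuousOn (hw.mono hab)
  refine ⟨max D 0 * C, by positivity, fun p r hr => ?_⟩
  rw [norm_mul, mul_assoc, mul_assoc, ← mul_assoc C]
  exact mul_le_mul ((hD r hr).trans (le_max_left _ _)) (hyC p r hr) (norm_nonneg _) (by positivity)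

lemma exists_norm_le_of_hasGrowthType_even_odd {I : Set ℝ} {τ : ℝ≥0} {u : ℕ → ℝ → ℂ}
    (heven : HasGrowthType I τ fun p => u (2 * p))
    (hodd : HasGrowthType I τ fun p => u (2 * p + 1)) {a b : ℝ} (hab : Icc a b ⊆ I)
    {ε : ℝ} (hε : 0 < ε) :
    ∃ C : ℝ, 0 ≤ C ∧ ∀ m : ℕ, ∀ r ∈ Icc a b, ‖u m r‖ ≤ C * m ! * (τ + ε) ^ m := by
  obtain ⟨C₀, hC₀, h₀⟩ := heven a b hab ε hε
  obtain ⟨C₁, hC₁, h₁⟩ := hodd a b hab ε hε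
  have : 0 < τ + ε := by positivity
  refine ⟨C₀ + C₁ / (τ + ε), by positivity, fun m r hr => ?_⟩
  obtain ⟨p, rfl | rfl⟩ := m.even_or_odd'
  · refine (h₀ p r hr).trans ?_
    gcongr
    exact le_add_of_nonneg_right (by positivity)
  · calc ‖u (2 * p + 1) r‖ ≤ C₁ * (2 * p)! * (τ + ε) ^ (2 * p) := h₁ p r hr
      _ = C₁ / (τ + ε) * (2 * p)! * (τ + ε) ^ (2 * p + 1) := by
          rw [pow_succ]
          field_simp
      _ ≤ (C₀ + C₁ / (τ + ε)) * (2 * p + 1)! * (τ + ε) ^ (2 * p + 1) := by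
          gcongr
          · exact le_add_of_nonneg_left hC₀
          · lia

lemma coe_lt_one_div_coe_iff {s t : ℝ≥0} : (s : ℝ≥0∞) < 1 / t ↔ (t : ℝ) * s < 1 := by
  rw [ENNReal.lt_div_iff_mul_lt (by simp) (by simp), mul_comm]
  exact_mod_cast Iff.rfl

lemma exists_pos_add_mul_lt_one {t s : ℝ} (hs : 0 ≤ s) (h : t * s < 1) :
    ∃ ε > 0, (t + ε) * s < 1 := by
  refine ⟨(1 - t * s) / (s + 1), div_pos (by linarith) (by linarith), ?_⟩
  have : (1 - t * s) / (s + 1) * s < 1 - t * s := by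
    rw [div_mul_eq_mul_div, div_lt_iff₀ (by linarith)]
    nlinarith
  linarith

lemma one_div_le_radius_ofScalars {c : ℕ → ℂ} {t : ℝ≥0}
    (hc : ∀ ε : ℝ, 0 < ε → ∃ C : ℝ, ∀ m, ‖c m‖ ≤ C * (t + ε) ^ m) :
    1 / (t : ℝ≥0∞) ≤ (FormalMultilinearSeries.ofScalars ℂ c).radius := by
  refine ENNReal.le_of_forall_nnreal_lt fun s hs => ?_
  obtain ⟨ε, hε, hεs⟩ := exists_pos_add_mul_lt_one s.2 (coe_lt_one_div_coe_iff.1 hs)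
  obtain ⟨C, hC⟩ := hc ε hε
  have hC0 : 0 ≤ C := by simpa using (norm_nonneg _).trans (hC 0)
  refine FormalMultilinearSeries.le_radius_of_bound _ C fun m => ?_
  calc ‖FormalMultilinearSeries.ofScalars ℂ c m‖ * (s : ℝ) ^ m
      ≤ C * (t + ε) ^ m * s ^ m := by
        rw [FormalMultilinearSeries.ofScalars_norm]
        gcongr
        exact hC m
    _ = C * ((t + ε) * s) ^ m := by rw [mul_pow, mul_assoc]
    _ ≤ C := mul_le_of_le_one_right hC0 (pow_le_one₀ (by positivity) hεs.le)

/-- The Taylor series of `u 0` at the point `ρ` if `u m` is the `m`-th derivative of `u 0`. -/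
noncomputable def taylorSeriesAt (u : ℕ → ℝ → ℂ) (ρ : ℝ) : FormalMultilinearSeries ℂ ℂ ℂ :=
  FormalMultilinearSeries.ofScalars ℂ fun m => u m ρ / m !

lemma one_div_le_radius_taylorSeriesAt {u : ℕ → ℝ → ℂ} {ρ : ℝ} {τ : ℝ≥0}
    (hu : ∀ ε : ℝ, 0 < ε → ∃ C : ℝ, ∀ m, ‖u m ρ‖ ≤ C * m ! * (τ + ε) ^ m) :
    1 / (τ : ℝ≥0∞) ≤ (taylorSeriesAt u ρ).radius := by
  refine one_div_le_radius_ofScalars fun ε hε => ?_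
  obtain ⟨C, hC⟩ := hu ε hε
  refine ⟨C, fun m => ?_⟩
  rw [norm_div, Complex.norm_natCast, div_le_iff₀ (by positivity)]
  exact (hC m).trans_eq (by ring)

lemma taylorSeriesAt_sum_eq {u : ℕ → ℝ → ℂ} {ρ r C T : ℝ} (hT : 0 ≤ T) (hTr : T * |r - ρ| < 1)
    (hu : ∀ m, ∀ t ∈ uIcc ρ r, HasDerivAt (u m) (u (m + 1) t) t)
    (hbound : ∀ m, ∀ t ∈ uIcc ρ r, ‖u m t‖ ≤ C * m ! * T ^ m) :
    (taylorSeriesAt u ρ).sum ((r : ℂ) - ρ) = u 0 r := by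
  rw [← (hasSum_taylor_of_norm_le hT hTr hu hbound).tsum_eq]
  refine tsum_congr fun m => ?_
  rw [taylorSeriesAt, FormalMultilinearSeries.ofScalars_apply_eq, Complex.real_smul, smul_eq_mul]
  push_cast
  ring

lemma one_div_two_mul_add_self (t : ℝ≥0∞) : 1 / (2 * t) + 1 / (2 * t) = 1 / t := by
  rw [one_div, one_div, ENNReal.mul_inv (by simp) (by simp), ← add_mul,
    ENNReal.inv_two_add_inv_two, one_mul]

lemma coe_nnnorm_ofReal_mem_Ioo {r₀ r₁ : ℝ≥0∞} {r : ℝ} (hr : r ∈ radii r₀ r₁) :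
    (‖(r : ℂ)‖₊ : ℝ≥0∞) ∈ Ioo r₀ r₁ := by
  rwa [Complex.nnnorm_real, ← enorm_eq_nnnorm, Real.enorm_of_nonneg (pos_of_mem_radii hr).le]

/-- The growth of the derivatives gives a Taylor series at any point `ρ < 1 / (2τ)` with radius of
convergence at least `1 / τ`, so that it can be recentred at `0`. -/
theorem exists_powerSeries_of_hasGrowthType {I : Set ℝ} (hI : I.OrdConnected) {τ : ℝ≥0}
    (hIτ : I ⊆ radii 0 (1 / (2 * τ))) {u : ℕ → ℝ → ℂ}
    (hu : ∀ m, ∀ r ∈ I, HasDerivAt (u m) (u (m + 1) r) r)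
    (heven : HasGrowthType I τ fun p => u (2 * p))
    (hodd : HasGrowthType I τ fun p => u (2 * p + 1)) :
    ∃ p : FormalMultilinearSeries ℂ ℂ ℂ, 1 / (2 * τ) ≤ p.radius ∧ ∀ r ∈ I, u 0 r = p.sum r := by
  rcases I.eq_empty_or_nonempty with rfl | ⟨ρ, hρ⟩
  · exact ⟨0, by simp, by simp⟩
  have hlt : ∀ r ∈ I, (‖(r : ℂ)‖₊ : ℝ≥0∞) < 1 / (2 * τ) := fun r hr =>
    (coe_nnnorm_ofReal_mem_Ioo (hIτ hr)).2
  have hadd : ∀ r ∈ I, (‖(r : ℂ)‖₊ + ‖(ρ : ℂ)‖₊ : ℝ≥0∞) < 1 / τ := fun r hr =>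
    (ENNReal.add_lt_add (hlt r hr) (hlt ρ hρ)).trans_eq (one_div_two_mul_add_self τ)
  have hradius : 1 / (τ : ℝ≥0∞) ≤ (taylorSeriesAt u ρ).radius := by
    refine one_div_le_radius_taylorSeriesAt fun ε hε => ?_
    obtain ⟨C, -, hC⟩ := exists_norm_le_of_hasGrowthType_even_odd heven hodd (hI.out hρ hρ) hε
    exact ⟨C, fun m => hC m ρ (by simp)⟩
  refine ⟨(taylorSeriesAt u ρ).changeOrigin (-ρ), le_trans ?_
    (FormalMultilinearSeries.changeOrigin_radius _), fun r hr => ?_⟩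
  · rw [nnnorm_neg]
    exact ENNReal.le_sub_of_add_le_right (by simp) <| (add_le_add_right (hlt ρ hρ).le _).trans <|
      (one_div_two_mul_add_self τ).trans_le hradius
  · have hdist : (τ : ℝ) * |r - ρ| < 1 := by
      have hsub : (‖(r : ℂ) - ρ‖₊ : ℝ≥0∞) < 1 / τ :=
        (mod_cast nnnorm_sub_le (r : ℂ) ρ : (‖(r : ℂ) - ρ‖₊ : ℝ≥0∞) ≤ ‖(r : ℂ)‖₊ + ‖(ρ : ℂ)‖₊)
          |>.trans_lt (hadd r hr)
      simpa [← Complex.ofReal_sub] using coe_lt_one_div_coe_iff.1 hsub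
    obtain ⟨ε, hε, hε1⟩ := exists_pos_add_mul_lt_one (abs_nonneg _) hdist
    have hρr : uIcc ρ r ⊆ I := hI.uIcc_subset hρ hr
    obtain ⟨C, -, hC⟩ := exists_norm_le_of_hasGrowthType_even_odd heven hodd hρr hε
    rw [FormalMultilinearSeries.changeOrigin_eval, neg_add_eq_sub]
    · exact (taylorSeriesAt_sum_eq (by positivity) hε1 (fun m t ht => hu m t (hρr ht)) hC).symm
    · rw [nnnorm_neg, add_comm]
      exact (hadd r hr).trans_le hradius

end GrowthType

section EvenSeries

/-- The even power series `∑ b_j z^(2j)`; the functions `evenPart a` and `oddPart a` are of this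
form. -/
noncomputable def evenSum (b : ℕ → ℂ) (z : ℂ) : ℂ := ∑' j : ℕ, b j * z ^ (2 * j)

/-- The even power series `∑ b_j z^(2j)` converges absolutely for `|z| < R`. -/
def EvenSummableBelow (R : ℝ≥0∞) (b : ℕ → ℂ) : Prop :=
  ∀ s : ℝ≥0, (s : ℝ≥0∞) < R → Summable fun j => ‖b j‖ * (s : ℝ) ^ (2 * j)

variable {R : ℝ≥0∞} {b : ℕ → ℂ}

lemma exists_mem_ball_of_enorm_lt {z : ℂ} (hz : ‖z‖ₑ < R) :
    ∃ s : ℝ≥0, (s : ℝ≥0∞) < R ∧ z ∈ Metric.ball (0 : ℂ) s := by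
  obtain ⟨s, hzs, hsR⟩ := ENNReal.lt_iff_exists_nnreal_btwn.1 hz
  exact ⟨s, hsR, mem_ball_zero_iff.2 (mod_cast hzs)⟩

lemma norm_mul_pow_two_mul_le (b : ℂ) {z : ℂ} {s : ℝ} (hz : ‖z‖ ≤ s) (j : ℕ) :
    ‖b * z ^ (2 * j)‖ ≤ ‖b‖ * s ^ (2 * j) := by
  rw [norm_mul, norm_pow]
  gcongr

lemma EvenSummableBelow.summable_norm (hb : EvenSummableBelow R b) {z : ℂ} (hz : ‖z‖ₑ < R) :
    Summable fun j => ‖b j * z ^ (2 * j)‖ := by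
  simpa using hb ‖z‖₊ hz

lemma EvenSummableBelow.of_norm_le {c : ℕ → ℂ} (hb : EvenSummableBelow R b)
    (hc : ∀ j, ‖c j‖ ≤ ‖b j‖) : EvenSummableBelow R c := fun s hs =>
  .of_nonneg_of_le (fun _ => by positivity) (fun j => by gcongr; exact hc j) (hb s hs)

lemma EvenSummableBelow.differentiableAt_evenSum (hb : EvenSummableBelow R b) {z : ℂ}
    (hz : ‖z‖ₑ < R) : DifferentiableAt ℂ (evenSum b) z := by
  obtain ⟨s, hsR, hz'⟩ := exists_mem_ball_of_enorm_lt hz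
  refine (Complex.differentiableOn_tsum_of_summable_norm (hb s hsR)
    (fun j => (by fun_prop : Differentiable ℂ fun w : ℂ => b j * w ^ (2 * j)).differentiableOn)
    Metric.isOpen_ball fun j w hw => ?_).differentiableAt (Metric.isOpen_ball.mem_nhds hz')
  exact norm_mul_pow_two_mul_le _ (mem_ball_zero_iff.1 hw).le j

lemma EvenSummableBelow.le_radius {a : ℕ → ℂ} (ha : EvenSummableBelow R fun j => a (2 * j)) :
    R ≤ (FormalMultilinearSeries.ofScalars ℂ fun n => if Even n then a n else 0).radius := by
  refine ENNReal.le_of_forall_nnreal_lt fun s hs => ?_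
  refine FormalMultilinearSeries.le_radius_of_summable _ ?_
  simp_rw [FormalMultilinearSeries.ofScalars_norm]
  refine (Function.Injective.summable_iff (mul_right_injective₀ two_ne_zero) fun n hn => ?_).1 ?_
  · have : ¬ Even n := fun ⟨m, hm⟩ => hn ⟨m, by simp [hm, two_mul]⟩
    simp [this]
  · simpa [Function.comp_def] using ha s hs

lemma EvenSummableBelow.div_natCast (hb : EvenSummableBelow R b) (q : ℕ) :
    EvenSummableBelow R fun j => b j / ((q + 2 * j + 1 : ℕ) : ℂ) :=
  hb.of_norm_le fun j => by
    rw [norm_div, Complex.norm_natCast]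
    exact div_le_self (norm_nonneg _) (by norm_cast; lia)

lemma EvenSummableBelow.hasDerivAt_pow_mul_evenSum (hb : EvenSummableBelow R b) (q : ℕ) {z : ℂ}
    (hz : ‖z‖ₑ < R) :
    HasDerivAt (fun w => w ^ (q + 1) * evenSum (fun j => b j / ((q + 2 * j + 1 : ℕ) : ℂ)) w)
      (z ^ q * evenSum b z) z := by
  obtain ⟨s, hsR, hz'⟩ := exists_mem_ball_of_enorm_lt hz
  have hs : 0 < (s : ℝ) := (norm_nonneg z).trans_lt (by simpa using hz')
  have hterm (j : ℕ) (w : ℂ) : HasDerivAt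
      (fun w => w ^ (q + 1) * (b j / ((q + 2 * j + 1 : ℕ) : ℂ) * w ^ (2 * j)))
      (w ^ q * (b j * w ^ (2 * j))) w := by
    have hpow (w : ℂ) : w ^ (q + 1) * (b j / ((q + 2 * j + 1 : ℕ) : ℂ) * w ^ (2 * j)) =
        b j / ((q + 2 * j + 1 : ℕ) : ℂ) * w ^ (q + 2 * j + 1) := by ring
    simp_rw [hpow]
    refine ((hasDerivAt_pow (q + 2 * j + 1) w).const_mul _).congr_deriv ?_
    rw [← mul_assoc, div_mul_cancel₀ _ (Nat.cast_ne_zero.2 (Nat.succ_ne_zero _)),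
      Nat.add_sub_cancel]
    ring
  have hbound (j : ℕ) (w : ℂ) (hw : w ∈ Metric.ball (0 : ℂ) s) :
      ‖w ^ q * (b j * w ^ (2 * j))‖ ≤ (s : ℝ) ^ q * (‖b j‖ * (s : ℝ) ^ (2 * j)) := by
    have hws : ‖w‖ ≤ s := (mem_ball_zero_iff.1 hw).le
    rw [norm_mul, norm_pow]
    gcongr
    exact norm_mul_pow_two_mul_le _ hws j
  simp_rw [evenSum, ← tsum_mul_left]
  exact hasDerivAt_tsum_of_isPreconnected ((hb s hsR).mul_left _) Metric.isOpen_ball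
    (convex_ball _ _).isPreconnected (fun j w _ => hterm j w) hbound (Metric.mem_ball_self hs)
    (by simp [summable_zero]) hz'

lemma EvenSummableBelow.cons (hb : EvenSummableBelow R b) (c : ℂ) :
    EvenSummableBelow R fun j => Nat.casesOn j c b := fun s hs => by
  refine (summable_nat_add_iff 1).1 (((hb s hs).mul_left ((s : ℝ) ^ 2)).congr fun j => ?_)
  ring

lemma EvenSummableBelow.evenSum_cons (hb : EvenSummableBelow R b) (c : ℂ) {z : ℂ}
    (hz : ‖z‖ₑ < R) :
    evenSum (fun j => Nat.casesOn j c b) z = c + z ^ 2 * evenSum b z := by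
  rw [evenSum, ((hb.cons c).summable_norm hz).of_norm.tsum_eq_zero_add, evenSum,
    ← tsum_mul_left]
  simp only [mul_zero, pow_zero, mul_one, mul_add]
  congr 1
  exact tsum_congr fun j => by ring

lemma evenSummableBelow_coeff_add (p : FormalMultilinearSeries ℂ ℂ ℂ) (q : ℕ) :
    EvenSummableBelow p.radius fun j => p.coeff (2 * j + q) := fun s hs => by
  obtain ⟨t, hst, htp⟩ := ENNReal.lt_iff_exists_nnreal_btwn.1 hs
  have ht : 0 < t := bot_le.trans_lt (ENNReal.coe_lt_coe.1 hst)
  have hinj : Function.Injective fun j => 2 * j + q := fun i j hij => by simpa using hij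
  refine .of_nonneg_of_le (fun _ => by positivity) (fun j => ?_)
    (((p.summable_norm_mul_pow htp).comp_injective hinj).div_const ((t : ℝ) ^ q))
  rw [le_div_iff₀ (by positivity), Function.comp_apply,
    FormalMultilinearSeries.norm_apply_eq_norm_coef, mul_assoc, pow_add]
  gcongr
  exact mod_cast hst.le

lemma sum_eq_mul_evenSum_add_evenSum (p : FormalMultilinearSeries ℂ ℂ ℂ) {z : ℂ}
    (hz : ‖z‖ₑ < p.radius) :
    p.sum z = z * evenSum (fun j => p.coeff (2 * j + 1)) z +
      evenSum (fun j => p.coeff (2 * j)) z := by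
  have hodd := ((evenSummableBelow_coeff_add p 1).summable_norm hz).of_norm.hasSum.mul_left z
  have heven := ((evenSummableBelow_coeff_add p 0).summable_norm hz).of_norm.hasSum
  rw [FormalMultilinearSeries.sum, add_comm]
  refine HasSum.tsum_eq (HasSum.even_add_odd (heven.congr_fun ?_) (hodd.congr_fun ?_)) <;>
  · intro j
    simp only [FormalMultilinearSeries.apply_eq_pow_smul_coeff, smul_eq_mul, add_zero]
    ring

end EvenSeries

section FrobeniusExpansion

/-- On `I`, the function `g` is a Frobenius solution `r^(2n+1) ∑ b_j r^(2j) + ∑ c_j r^(2j)`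
with both series convergent below `R`. The exponents `2n+1` and `0` are the indicial roots at the
origin of the operator `y'' - (2n / r) y'`. -/
def HasFrobeniusExpansion (I : Set ℝ) (R : ℝ≥0∞) (n : ℕ) (g : ℝ → ℂ) : Prop :=
  ∃ b c : ℕ → ℂ, EvenSummableBelow R b ∧ EvenSummableBelow R c ∧
    ∀ r ∈ I, g r = (r : ℂ) ^ (2 * n + 1) * evenSum b r + evenSum c r

lemma hasFrobeniusExpansion_zero_of_eq_sum {I : Set ℝ} {R : ℝ≥0∞} {g : ℝ → ℂ}
    (hIR : I ⊆ radii 0 R) {p : FormalMultilinearSeries ℂ ℂ ℂ} (hp : R ≤ p.radius)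
    (hg : ∀ r ∈ I, g r = p.sum r) : HasFrobeniusExpansion I R 0 g :=
  ⟨fun j => p.coeff (2 * j + 1), fun j => p.coeff (2 * j),
    fun s hs => evenSummableBelow_coeff_add p 1 s (hs.trans_le hp),
    fun s hs => evenSummableBelow_coeff_add p 0 s (hs.trans_le hp), fun r hr => by
      rw [hg r hr, sum_eq_mul_evenSum_add_evenSum p
        ((coe_nnnorm_ofReal_mem_Ioo (hIR hr)).2.trans_le hp), mul_zero, zero_add, pow_one]⟩

lemma HasFrobeniusExpansion.of_hasDerivAt {I : Set ℝ} {R : ℝ≥0∞} {n : ℕ} {g h : ℝ → ℂ}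
    (hI : IsOpen I) (hI' : I.OrdConnected) (hIR : I ⊆ radii 0 R)
    (hh : HasFrobeniusExpansion I R n h) (hg : ∀ r ∈ I, HasDerivAt g (r * h r) r) :
    HasFrobeniusExpansion I R (n + 1) g := by
  obtain ⟨b, c, hb, hc, heq⟩ := hh
  have hlt (r : ℝ) (hr : r ∈ I) : ‖(r : ℂ)‖ₑ < R := (coe_nnnorm_ofReal_mem_Ioo (hIR hr)).2
  set b' : ℕ → ℂ := fun j => b j / ((2 * n + 2 + 2 * j + 1 : ℕ) : ℂ)
  set c' : ℕ → ℂ := fun j => c j / ((1 + 2 * j + 1 : ℕ) : ℂ)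
  set G : ℝ → ℂ := fun r => (r : ℂ) ^ (2 * n + 2 + 1) * evenSum b' r + (r : ℂ) ^ 2 * evenSum c' r
  have hG (r : ℝ) (hr : r ∈ I) : HasDerivAt G (r * h r) r := by
    refine ((hb.hasDerivAt_pow_mul_evenSum (2 * n + 2) (hlt r hr)).comp_ofReal.add
      (hc.hasDerivAt_pow_mul_evenSum 1 (hlt r hr)).comp_ofReal).congr_deriv ?_
    rw [heq r hr]
    ring
  obtain ⟨A, hA⟩ := hI.exists_eq_add_of_deriv_eq hI'.isPreconnected
    (fun r hr => (hg r hr).differentiableAt.differentiableWithinAt)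
    (fun r hr => (hG r hr).differentiableAt.differentiableWithinAt)
    (fun r hr => (hg r hr).deriv.trans (hG r hr).deriv.symm)
  have hc' : EvenSummableBelow R c' := hc.div_natCast 1
  refine ⟨b', _, hb.div_natCast _, hc'.cons A, fun r hr => ?_⟩
  rw [hc'.evenSum_cons A (hlt r hr), hA hr]
  ring

end FrobeniusExpansion

section Interleave

/-- The sequence with even terms `b` and odd terms `c`; it merges the coefficients of two even power
series, and the even and odd derivatives of a function, into one sequence. -/
def interleave {α : Type*} (b c : ℕ → α) (n : ℕ) : α := if Even n then b (n / 2) else c (n / 2)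

lemma interleave_two_mul {α : Type*} (b c : ℕ → α) (j : ℕ) : interleave b c (2 * j) = b j := by
  simp [interleave]

lemma interleave_two_mul_add_one {α : Type*} (b c : ℕ → α) (j : ℕ) :
    interleave b c (2 * j + 1) = c j := by
  have hhalf : (2 * j + 1) / 2 = j := by lia
  simp [interleave, hhalf, parity_simps]

end Interleave

section RadialChain

lemma norm_integral_smul_sub_le {F : Type*} [NormedAddCommGroup F] [NormedSpace ℝ F]
    {w : ℝ → ℝ} {v v' : ℝ → F} {a b B : ℝ} (hab : a ≤ b) (hw : IntervalIntegrable w volume a b)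
    (hw0 : ∀ r ∈ Icc a b, 0 ≤ w r) (hv : ∀ r ∈ Icc a b, HasDerivAt v (v' r) r)
    (hB : ∀ r ∈ Icc a b, ‖v' r‖ ≤ B) {x : ℝ} (hx : x ∈ Icc a b) :
    ‖∫ r in a..b, w r • (v r - v x)‖ ≤ (∫ r in a..b, w r) * (B * (b - a)) := by
  have hB0 : 0 ≤ B := (norm_nonneg _).trans (hB x hx)
  rw [← intervalIntegral.integral_mul_const]
  refine intervalIntegral.norm_integral_le_of_norm_le hab (ae_of_all _ fun r hr => ?_)
    (hw.mul_const _)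
  have hrI := Ioc_subset_Icc_self hr
  have hmean := (convex_Icc a b).norm_image_sub_le_of_norm_hasDerivWithin_le
    (fun t ht => (hv t ht).hasDerivWithinAt) hB hx hrI
  rw [norm_smul, Real.norm_of_nonneg (hw0 r hrI)]
  exact mul_le_mul_of_nonneg_left
    (hmean.trans (mul_le_mul_of_nonneg_left (Real.dist_le_of_mem_Icc hrI hx) hB0)) (hw0 r hrI)

/-- Landau's argument: `y b - y a` is the integral of `w • v`, and `v` is nearly constant because
its derivative is bounded. -/
lemma norm_le_of_hasDerivAt_smul {F : Type*} [NormedAddCommGroup F] [NormedSpace ℝ F]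
    [CompleteSpace F] {w : ℝ → ℝ} {y v v' : ℝ → F} {a b A B : ℝ} (hab : a < b)
    (hw : ContinuousOn w (Icc a b)) (hwpos : ∀ r ∈ Icc a b, 0 < w r)
    (hy : ∀ r ∈ Icc a b, HasDerivAt y (w r • v r) r)
    (hv : ∀ r ∈ Icc a b, HasDerivAt v (v' r) r)
    (hA : ∀ r ∈ Icc a b, ‖y r‖ ≤ A) (hB : ∀ r ∈ Icc a b, ‖v' r‖ ≤ B) {x : ℝ}
    (hx : x ∈ Icc a b) :
    ‖v x‖ ≤ 2 * A / (∫ r in a..b, w r) + B * (b - a) := by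
  have hv_cont : ContinuousOn v (Icc a b) := fun r hr =>
    (hv r hr).continuousAt.continuousWithinAt
  have hw_int : IntervalIntegrable w volume a b := hw.intervalIntegrable_of_Icc hab.le
  have hwv_int : IntervalIntegrable (fun r => w r • v r) volume a b :=
    (hw.smul hv_cont).intervalIntegrable_of_Icc hab.le
  have hwvx_int : IntervalIntegrable (fun r => w r • v x) volume a b :=
    (hw.smul continuousOn_const).intervalIntegrable_of_Icc hab.le
  have hpos : 0 < ∫ r in a..b, w r := intervalIntegral.intervalIntegral_pos_of_pos_on hw_int
    (fun r hr => hwpos r (Ioo_subset_Icc_self hr)) hab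
  have hsplit : (∫ r in a..b, w r) • v x = (y b - y a) - ∫ r in a..b, w r • (v r - v x) := by
    rw [← intervalIntegral.integral_eq_sub_of_hasDerivAt
      (fun r hr => hy r (uIcc_of_le hab.le ▸ hr)) hwv_int]
    simp_rw [smul_sub]
    rw [intervalIntegral.integral_sub hwv_int hwvx_int, intervalIntegral.integral_smul_const,
      sub_sub_cancel]
  have hrem := norm_integral_smul_sub_le hab.le hw_int (fun r hr => (hwpos r hr).le) hv hB hx
  have hbound : (∫ r in a..b, w r) * ‖v x‖ ≤
      (A + A) + (∫ r in a..b, w r) * (B * (b - a)) := by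
    rw [← Real.norm_of_nonneg hpos.le, ← norm_smul, hsplit, Real.norm_of_nonneg hpos.le]
    exact (norm_sub_le _ _).trans (add_le_add ((norm_sub_le _ _).trans
      (add_le_add (hA b (right_mem_Icc.2 hab.le)) (hA a (left_mem_Icc.2 hab.le)))) hrem)
  rw [div_add' _ _ _ hpos.ne', le_div_iff₀ hpos]
  linarith

/-- The functions `y p` and `v p` satisfy `y p' = r^(2n) v p` and `v p' = r^(-2n) y (p + 1)` on `I`,
so that `y (p + 1)` is the image of `y p` under the operator `y'' - (2n / r) y'`. -/
structure IsRadialChain (I : Set ℝ) (n : ℕ) (y v : ℕ → ℝ → ℂ) : Prop where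
  deriv_fst : ∀ p, ∀ r ∈ I, HasDerivAt (y p) ((r : ℂ) ^ (2 * n) * v p r) r
  deriv_snd : ∀ p, ∀ r ∈ I, HasDerivAt (v p) (((r : ℂ) ^ (2 * n))⁻¹ * y (p + 1) r) r

variable {I : Set ℝ} {τ : ℝ≥0} {n : ℕ} {y v : ℕ → ℝ → ℂ}

lemma IsRadialChain.hasGrowthType_snd (h : IsRadialChain I n y v) (hI : IsOpen I)
    (hpos : ∀ r ∈ I, 0 < r) (hy : HasGrowthType I τ y) : HasGrowthType I τ v := by
  intro a b hab ε hε
  rcases lt_or_ge b a with hba | hba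
  · exact ⟨0, le_rfl, fun p r hr => absurd (hr.1.trans hr.2) hba.not_ge⟩
  obtain ⟨b', hbb', hb'⟩ : ∃ b' > b, Icc b b' ⊆ I :=
    mem_nhdsGE_iff_exists_Icc_subset.1
      (mem_nhdsWithin_of_mem_nhds (hI.mem_nhds (hab (right_mem_Icc.2 hba))))
  have hI' : Icc a b' ⊆ I := by
    rw [← Icc_union_Icc_eq_Icc hba (le_of_lt hbb')]
    exact union_subset hab hb'
  have ha : 0 < a := hpos a (hab (left_mem_Icc.2 hba))
  have hab' : a < b' := hba.trans_lt hbb'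
  obtain ⟨C₁, hC₁, h₁⟩ := hy a b' hI' ε hε
  obtain ⟨C₂, hC₂, h₂⟩ := hy.shift a b' hI' ε hε
  have hJ : 0 ≤ ∫ r in a..b', r ^ (2 * n) := intervalIntegral.integral_nonneg hab'.le
    fun r hr => pow_nonneg (ha.le.trans hr.1) _
  refine ⟨2 * C₁ / (∫ r in a..b', r ^ (2 * n)) + (a ^ (2 * n))⁻¹ * C₂ * (b' - a),
    add_nonneg (by positivity) (mul_nonneg (by positivity) (sub_nonneg.2 hab'.le)),
    fun p x hx => ?_⟩
  set G : ℝ := (2 * p)! * (τ + ε) ^ (2 * p)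
  refine (norm_le_of_hasDerivAt_smul (w := fun r => r ^ (2 * n)) (y := y p) (A := C₁ * G)
    (B := (a ^ (2 * n))⁻¹ * (C₂ * G)) hab' (by fun_prop)
    (fun r hr => pow_pos (ha.trans_le hr.1) _) (fun r hr => ?_)
    (fun r hr => h.deriv_snd p r (hI' hr)) (fun r hr => ?_) (fun r hr => ?_)
    ⟨hx.1, hx.2.trans (le_of_lt hbb')⟩).trans_eq (by ring)
  · exact (h.deriv_fst p r (hI' hr)).congr_deriv (by simp)
  · exact (h₁ p r hr).trans_eq (by ring)
  · rw [norm_mul, norm_inv, norm_pow, Complex.norm_real, Real.norm_of_nonneg (ha.le.trans hr.1)]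
    gcongr
    · exact hr.1
    · exact (h₂ p r hr).trans_eq (by ring)

lemma hasDerivAt_ofReal_pow (q : ℕ) (r : ℝ) :
    HasDerivAt (fun t : ℝ => (t : ℂ) ^ (q + 1)) ((q + 1 : ℂ) * (r : ℂ) ^ q) r := by
  simpa using (hasDerivAt_pow (q + 1) (r : ℂ)).comp_ofReal

lemma hasDerivAt_inv_ofReal_pow (q : ℕ) {r : ℝ} (hr : r ≠ 0) :
    HasDerivAt (fun t : ℝ => ((t : ℂ) ^ q)⁻¹) (-q * ((r : ℂ) ^ (q + 1))⁻¹) r := by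
  have h := (hasDerivAt_zpow (-q : ℤ) (r : ℂ) (by simp [hr])).comp_ofReal
  rw [show (-q - 1 : ℤ) = -((q + 1 : ℕ) : ℤ) by push_cast; ring] at h
  simpa only [zpow_neg, zpow_natCast, Int.cast_neg, Int.cast_natCast] using h

/-- The operator `y ↦ y' / r` maps chains of order `n + 1` to chains of order `n`. -/
lemma IsRadialChain.descend (h : IsRadialChain I (n + 1) y v) (hpos : ∀ r ∈ I, 0 < r) :
    IsRadialChain I n (fun p r => (r : ℂ) ^ (2 * n + 1) * v p r)
      (fun p r => ((r : ℂ) ^ (2 * n + 1))⁻¹ * y (p + 1) r + (2 * n + 1) * v p r) where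
  deriv_fst p r hr := by
    have hr' : (r : ℂ) ≠ 0 := mod_cast (hpos r hr).ne'
    refine ((hasDerivAt_ofReal_pow (2 * n) r).mul (h.deriv_snd p r hr)).congr_deriv ?_
    push_cast
    field_simp
    ring
  deriv_snd p r hr := by
    have hr' : (r : ℂ) ≠ 0 := mod_cast (hpos r hr).ne'
    refine (((hasDerivAt_inv_ofReal_pow (2 * n + 1) (hpos r hr).ne').mul
      (h.deriv_fst (p + 1) r hr)).add
      ((h.deriv_snd p r hr).const_mul (2 * n + 1 : ℂ))).congr_deriv ?_
    push_cast
    field_simp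
    ring

lemma IsRadialChain.hasFrobeniusExpansion_of_order_zero (h : IsRadialChain I 0 y v)
    (hI' : I.OrdConnected) (hIτ : I ⊆ radii 0 (1 / (2 * τ)))
    (hy : HasGrowthType I τ y) (hv : HasGrowthType I τ v) :
    HasFrobeniusExpansion I (1 / (2 * τ)) 0 (y 0) := by
  have hderiv (m : ℕ) (r : ℝ) (hr : r ∈ I) :
      HasDerivAt (interleave y v m) (interleave y v (m + 1) r) r := by
    obtain ⟨p, rfl | rfl⟩ := m.even_or_odd'
    · simpa [interleave_two_mul, interleave_two_mul_add_one] using h.deriv_fst p r hr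
    · rw [interleave_two_mul_add_one, show 2 * p + 1 + 1 = 2 * (p + 1) by ring, interleave_two_mul]
      simpa using h.deriv_snd p r hr
  obtain ⟨P, hPradius, hPsum⟩ := exists_powerSeries_of_hasGrowthType hI' hIτ hderiv
    (by simpa only [interleave_two_mul] using hy)
    (by simpa only [interleave_two_mul_add_one] using hv)
  have hzero : interleave y v 0 = y 0 := interleave_two_mul y v 0
  rw [hzero] at hPsum
  exact hasFrobeniusExpansion_zero_of_eq_sum hIτ hPradius hPsum

theorem IsRadialChain.hasFrobeniusExpansion (hI : IsOpen I) (hI' : I.OrdConnected)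
    (hIτ : I ⊆ radii 0 (1 / (2 * τ))) (h : IsRadialChain I n y v) (hy : HasGrowthType I τ y) :
    HasFrobeniusExpansion I (1 / (2 * τ)) n (y 0) := by
  have hpos : ∀ r ∈ I, 0 < r := fun r hr => pos_of_mem_radii (hIτ hr)
  have hv := h.hasGrowthType_snd hI hpos hy
  induction n generalizing y v with
  | zero => exact h.hasFrobeniusExpansion_of_order_zero hI' hIτ hy hv
  | succ n ih =>
    have hdesc := h.descend hpos
    have hgrowth := hv.continuousOn_mul (w := fun r : ℝ => (r : ℂ) ^ (2 * n + 1)) (by fun_prop)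
    refine (ih hdesc hgrowth (hdesc.hasGrowthType_snd hI hpos hgrowth)).of_hasDerivAt hI hI' hIτ
      fun r hr => (h.deriv_fst 0 r hr).congr_deriv (by ring)

end RadialChain

open scoped RealInnerProductSpace

lemma hasDerivAt_integral_of_continuousOn {X G : Type*} [TopologicalSpace X] [CompactSpace X]
    [MeasurableSpace X] [OpensMeasurableSpace X] {μ : Measure X} [IsFiniteMeasure μ]
    [NormedAddCommGroup G] [NormedSpace ℝ G] {Φ Φ' : ℝ → X → G} {s : Set ℝ} (hs : IsOpen s)
    (hΦ : ContinuousOn (Function.uncurry Φ) (s ×ˢ univ))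
    (hΦ' : ContinuousOn (Function.uncurry Φ') (s ×ˢ univ))
    (hd : ∀ t ∈ s, ∀ x, HasDerivAt (fun t => Φ t x) (Φ' t x) t) {t₀ : ℝ} (ht₀ : t₀ ∈ s) :
    HasDerivAt (fun t => ∫ x, Φ t x ∂μ) (∫ x, Φ' t₀ x ∂μ) t₀ := by
  obtain ⟨ε, hε, hεs⟩ := Metric.nhds_basis_closedBall.mem_iff.1 (hs.mem_nhds ht₀)
  obtain ⟨C, hC⟩ := ((isCompact_closedBall t₀ ε).prod
    (isCompact_univ (X := X))).exists_bound_of_continuousOn (hΦ'.mono (prod_mono hεs subset_rfl))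
  have integrable_slice : ∀ {Ψ : ℝ → X → G}, ContinuousOn (Function.uncurry Ψ) (s ×ˢ univ) →
      ∀ t ∈ s, Integrable (Ψ t) μ := fun hΨ t ht =>
    (hΨ.comp_continuous (f := fun x => (t, x)) (by fun_prop)
      (fun x => ⟨ht, mem_univ _⟩)).integrable_of_hasCompactSupport
      (HasCompactSupport.of_compactSpace _)
  refine (hasDerivAt_integral_of_dominated_loc_of_deriv_le (bound := fun _ => C)
    (Metric.closedBall_mem_nhds t₀ hε) ?_ (integrable_slice hΦ t₀ ht₀)
    (integrable_slice hΦ' t₀ ht₀).aestronglyMeasurable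
    (ae_of_all _ fun x t ht => hC (t, x) ⟨ht, mem_univ _⟩) (integrable_const _)
    (ae_of_all _ fun x t ht => hd t (hεs ht) x)).2
  filter_upwards [hs.mem_nhds ht₀] with t ht
  exact (integrable_slice hΦ t ht).aestronglyMeasurable

section DerivAlong

variable {E G : Type*} [NormedAddCommGroup E] [NormedSpace ℝ E] [NormedAddCommGroup G]
  [NormedSpace ℝ G] {s : Set E} {F : E → G} {x : E}

/-- The derivative of `F` along the linear vector field `x ↦ B x`; for `B = id` this is the Euler
operator `∑ xᵢ ∂F/∂xᵢ`. -/
noncomputable def derivAlong (B : E →L[ℝ] E) (F : E → G) (x : E) : G := fderiv ℝ F x (B x)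

lemma contDiffOn_derivAlong (hs : IsOpen s) (hF : ContDiffOn ℝ ∞ F s) (B : E →L[ℝ] E) :
    ContDiffOn ℝ ∞ (derivAlong B F) s :=
  (hF.fderiv_of_isOpen hs (m := ∞) (by simp)).clm_apply B.contDiff.contDiffOn

lemma derivAlong_derivAlong (hF : ContDiffAt ℝ ∞ F x) (B : E →L[ℝ] E) :
    derivAlong B (derivAlong B F) x =
      fderiv ℝ (fderiv ℝ F) x (B x) (B x) + fderiv ℝ F x (B (B x)) := by
  have hF' : DifferentiableAt ℝ (fderiv ℝ F) x :=
    (hF.fderiv_right (m := ∞) (by simp)).differentiableAt (by simp)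
  have hder : fderiv ℝ (derivAlong B F) x = _ :=
    (hF'.hasFDerivAt.clm_apply B.hasFDerivAt).fderiv
  rw [derivAlong, hder]
  simp [add_comm]

lemma derivAlong_mul {F Q : E → ℂ} (hF : DifferentiableAt ℝ F x) (hQ : DifferentiableAt ℝ Q x)
    (B : E →L[ℝ] E) :
    derivAlong B (fun x => F x * Q x) x = derivAlong B F x * Q x + F x * derivAlong B Q x := by
  have hder : fderiv ℝ (fun x => F x * Q x) x = _ := (hF.hasFDerivAt.mul hQ.hasFDerivAt).fderiv
  rw [derivAlong, hder]
  simp only [derivAlong, add_apply, smul_apply, smul_eq_mul]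
  ring

lemma derivAlong_sub {F Q : E → G} (hF : DifferentiableAt ℝ F x) (hQ : DifferentiableAt ℝ Q x)
    (B : E →L[ℝ] E) :
    derivAlong B (fun x => F x - Q x) x = derivAlong B F x - derivAlong B Q x := by
  simp only [derivAlong, fderiv_fun_sub hF hQ, sub_apply]

end DerivAlong

lemma continuous_comp_smul_sphere {E G : Type*} [NormedAddCommGroup E] [NormedSpace ℝ E]
    [TopologicalSpace G] {s : Set E} {F : E → G} (hF : ContinuousOn F s) {r : ℝ}
    (hr : ∀ θ : Metric.sphere (0 : E) 1, r • θ.1 ∈ s) :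
    Continuous fun θ : Metric.sphere (0 : E) 1 => F (r • θ.1) :=
  hF.comp_continuous (by fun_prop) hr

lemma exists_rotation_flow {E : Type*} [NormedAddCommGroup E] [InnerProductSpace ℝ E]
    [CompleteSpace E] {B : E →L[ℝ] E} (hB : B ∈ skewAdjoint (E →L[ℝ] E)) :
    ∃ U : ℝ → (E ≃ₗᵢ[ℝ] E), (∀ x, U 0 x = x) ∧
      (∀ t x, HasDerivAt (fun t => U t x) (B (U t x)) t) ∧
      Continuous fun p : ℝ × E => U p.1 p.2 := by
  let _ : NormedAlgebra ℚ (E →L[ℝ] E) := NormedAlgebra.restrictScalars ℚ ℝ (E →L[ℝ] E)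
  have hunitary : ∀ t : ℝ, NormedSpace.exp (t • B) ∈ unitary (E →L[ℝ] E) := fun t =>
    NormedSpace.exp_mem_unitary_of_mem_skewAdjoint (skewAdjoint.smul_mem t hB)
  have hderiv : ∀ t : ℝ, HasDerivAt (fun t : ℝ => NormedSpace.exp (t • B))
      (B * NormedSpace.exp (t • B)) t := fun t => hasDerivAt_exp_smul_const' (𝕂 := ℝ) B t
  refine ⟨fun t => Unitary.linearIsometryEquiv ⟨_, hunitary t⟩, fun x => ?_, fun t x => ?_, ?_⟩
  · change NormedSpace.exp ((0 : ℝ) • B) x = x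
    rw [show (0 : ℝ) • B = 0 from zero_smul ℝ B, NormedSpace.exp_zero]
    rfl
  · have hx := (hderiv t).clm_apply (hasDerivAt_const t x)
    rwa [ContinuousLinearMap.map_zero, add_zero] at hx
  · have hcont : Continuous fun t : ℝ => NormedSpace.exp (t • B) :=
      continuous_iff_continuousAt.2 fun t => (hderiv t).continuousAt
    exact (hcont.comp continuous_fst).clm_apply continuous_snd

section SphereIntegral

variable {E G : Type*} [NormedAddCommGroup E] [InnerProductSpace ℝ E] [FiniteDimensional ℝ E]
  [MeasurableSpace E] [BorelSpace E] [NormedAddCommGroup G]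

local notation "𝕊" => Metric.sphere (0 : E) 1
local notation "σ" => Measure.toSphere (volume : Measure E)

lemma integrable_toSphere_of_continuous {u : 𝕊 → G} (hu : Continuous u) : Integrable u σ :=
  hu.integrable_of_hasCompactSupport (HasCompactSupport.of_compactSpace _)

variable [NormedSpace ℝ G]

/-- The action of a linear isometry on the unit sphere. -/
def sphereMap {E : Type*} [NormedAddCommGroup E] [NormedSpace ℝ E] (U : E ≃ₗᵢ[ℝ] E)
    (θ : Metric.sphere (0 : E) 1) : Metric.sphere (0 : E) 1 :=
  ⟨U θ, by simp⟩

open scoped Pointwise in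
lemma measurePreserving_sphereMap (U : E ≃ₗᵢ[ℝ] E) : MeasurePreserving (sphereMap U) σ σ := by
  have hmeas : Measurable (sphereMap U) :=
    ((U.continuous.comp continuous_subtype_val).subtype_mk _).measurable
  refine ⟨hmeas, Measure.ext fun s hs => ?_⟩
  have hcone : Ioo (0 : ℝ) 1 • ((↑) '' (sphereMap U ⁻¹' s) : Set E)
      = U ⁻¹' (Ioo (0 : ℝ) 1 • ((↑) '' s : Set E)) := by
    ext x
    simp only [Set.mem_smul, mem_image, mem_preimage]
    constructor
    · rintro ⟨r, hr, _, ⟨θ, hθ, rfl⟩, rfl⟩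
      exact ⟨r, hr, _, ⟨_, hθ, rfl⟩, by simp [sphereMap]⟩
    · rintro ⟨r, hr, _, ⟨θ, hθ, rfl⟩, h⟩
      exact ⟨r, hr, _, ⟨sphereMap U.symm θ, by simpa [sphereMap] using hθ, rfl⟩,
        U.injective (by simp [sphereMap, h])⟩
  rw [Measure.map_apply hmeas hs, Measure.toSphere_apply' _ (hmeas hs),
    Measure.toSphere_apply' _ hs, hcone]
  exact congrArg _
    (U.measurePreserving.measure_preimage_equiv (f := U.toMeasurableEquiv) _)

lemma integral_sphereMap (U : E ≃ₗᵢ[ℝ] E) (u : 𝕊 → G) :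
    ∫ θ, u (sphereMap U θ) ∂σ = ∫ θ, u θ ∂σ := by
  have hemb : MeasurableEmbedding (sphereMap U) := by
    refine (Continuous.isClosedEmbedding
      ((U.continuous.comp continuous_subtype_val).subtype_mk _) ?_).measurableEmbedding
    exact fun θ₁ θ₂ h => Subtype.ext (U.injective (congrArg Subtype.val h))
  exact (measurePreserving_sphereMap U).integral_comp hemb u

/-- The integral of `u` over the sphere is constant along the rotations `exp (t B)`. -/
lemma integral_derivAlong_eq_zero {s : Set E} (hs : IsOpen s) {u : E → G}
    (hu : ContDiffOn ℝ ∞ u s) {r : ℝ} (hr : ∀ θ : 𝕊, r • θ.1 ∈ s) {B : E →L[ℝ] E}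
    (hB : B ∈ skewAdjoint (E →L[ℝ] E)) :
    ∫ θ : 𝕊, derivAlong B u (r • θ.1) ∂σ = 0 := by
  obtain ⟨U, hU0, hderiv, hcont⟩ := exists_rotation_flow hB
  have hcontU : Continuous fun p : ℝ × 𝕊 => r • U p.1 p.2.1 :=
    (hcont.comp (continuous_fst.prodMk (continuous_subtype_val.comp continuous_snd))).const_smul r
  have hmem : ∀ t : ℝ, ∀ θ : 𝕊, r • U t θ.1 ∈ s := fun t θ => hr (sphereMap (U t) θ)
  have hint := hasDerivAt_integral_of_continuousOn (μ := σ) (s := univ)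
    (Φ := fun t θ => u (r • U t θ.1)) (Φ' := fun t θ => derivAlong B u (r • U t θ.1)) isOpen_univ
    (hu.continuousOn.comp hcontU.continuousOn fun p _ => hmem p.1 p.2)
    ((contDiffOn_derivAlong hs hu B).continuousOn.comp hcontU.continuousOn
      fun p _ => hmem p.1 p.2)
    (fun t _ θ => ?_) (mem_univ 0)
  · have hconst : ∀ t : ℝ, ∫ θ : 𝕊, u (r • U t θ.1) ∂σ = ∫ θ : 𝕊, u (r • θ.1) ∂σ := fun t =>
      integral_sphereMap (U t) fun θ : 𝕊 => u (r • θ.1)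
    simp only [hconst] at hint
    simpa [hU0] using hint.unique (hasDerivAt_const _ _)
  · have hux : HasFDerivAt u (fderiv ℝ u (r • U t θ.1)) (r • U t θ.1) :=
      ((hu.contDiffAt (hs.mem_nhds (hmem t θ))).differentiableAt (by simp)).hasFDerivAt
    refine (hux.comp_hasDerivAt t ((hderiv t θ.1).const_smul r)).congr_deriv ?_
    simp [derivAlong]

/-- The difference of the two integrands is the derivative of `(B F) Q - F (B Q)` along `B`. -/
lemma integral_derivAlong_derivAlong_mul {s : Set E} (hs : IsOpen s) {F Q : E → ℂ}
    (hF : ContDiffOn ℝ ∞ F s) (hQ : ContDiffOn ℝ ∞ Q s) {r : ℝ} (hr : ∀ θ : 𝕊, r • θ.1 ∈ s)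
    {B : E →L[ℝ] E} (hB : B ∈ skewAdjoint (E →L[ℝ] E)) :
    ∫ θ : 𝕊, derivAlong B (derivAlong B F) (r • θ.1) * Q (r • θ.1) ∂σ =
      ∫ θ : 𝕊, F (r • θ.1) * derivAlong B (derivAlong B Q) (r • θ.1) ∂σ := by
  have hF' := contDiffOn_derivAlong hs hF B
  have hQ' := contDiffOn_derivAlong hs hQ B
  have hF'' := contDiffOn_derivAlong hs hF' B
  have hQ'' := contDiffOn_derivAlong hs hQ' B
  have hdiff : ∀ {H : E → ℂ}, ContDiffOn ℝ ∞ H s → ∀ θ : 𝕊, DifferentiableAt ℝ H (r • θ.1) :=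
    fun hH θ => (hH.contDiffAt (hs.mem_nhds (hr θ))).differentiableAt (by simp)
  have hwronskian : ∀ θ : 𝕊,
      derivAlong B (fun x => derivAlong B F x * Q x - F x * derivAlong B Q x) (r • θ.1)
      = derivAlong B (derivAlong B F) (r • θ.1) * Q (r • θ.1)
        - F (r • θ.1) * derivAlong B (derivAlong B Q) (r • θ.1) := fun θ => by
    rw [derivAlong_sub (hdiff (hF'.mul hQ) θ) (hdiff (hF.mul hQ') θ),
      derivAlong_mul (hdiff hF' θ) (hdiff hQ θ), derivAlong_mul (hdiff hF θ) (hdiff hQ' θ)]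
    ring
  have hzero := integral_derivAlong_eq_zero hs ((hF'.mul hQ).sub (hF.mul hQ')) hr hB
  simp only [hwronskian] at hzero
  rw [integral_sub] at hzero
  · exact sub_eq_zero.1 hzero
  · exact integrable_toSphere_of_continuous
      (continuous_comp_smul_sphere (hF''.mul hQ).continuousOn hr)
  · exact integrable_toSphere_of_continuous
      (continuous_comp_smul_sphere (hF.mul hQ'').continuousOn hr)

end SphereIntegral

section AngularLaplacian

variable {E : Type*} [NormedAddCommGroup E] [InnerProductSpace ℝ E]

/-- The skew-adjoint map `x ↦ ⟪u, x⟫ v - ⟪v, x⟫ u`, which generates the rotations in the plane of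
`u` and `v`. -/
noncomputable def infinitesimalRotation (u v : E) : E →L[ℝ] E :=
  (innerSL ℝ u).smulRight v - (innerSL ℝ v).smulRight u

lemma infinitesimalRotation_apply (u v x : E) :
    infinitesimalRotation u v x = ⟪u, x⟫ • v - ⟪v, x⟫ • u := rfl

lemma infinitesimalRotation_mem_skewAdjoint [CompleteSpace E] (u v : E) :
    infinitesimalRotation u v ∈ skewAdjoint (E →L[ℝ] E) := by
  rw [skewAdjoint.mem_iff, ContinuousLinearMap.star_eq_adjoint, eq_comm,
    ContinuousLinearMap.eq_adjoint_iff]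
  intro x y
  simp only [neg_apply, infinitesimalRotation_apply, inner_neg_left, inner_sub_left,
    inner_sub_right, real_inner_smul_left, real_inner_smul_right, real_inner_comm x]
  ring

variable {ι : Type*} [Fintype ι] (b : OrthonormalBasis ι ℝ E)
  {G : Type*} [NormedAddCommGroup G] [NormedSpace ℝ G]

lemma sum_sum_infinitesimalRotation_infinitesimalRotation (x : E) :
    ∑ i, ∑ j, infinitesimalRotation (b i) (b j) (infinitesimalRotation (b i) (b j) x) =
      (2 - 2 * (Fintype.card ι : ℝ)) • x := by
  classical
  have hterm : ∀ i j,
      infinitesimalRotation (b i) (b j) (infinitesimalRotation (b i) (b j) x) =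
        (if i = j then (2 : ℝ) • ⟪b i, x⟫ • b i else 0) - ⟪b j, x⟫ • b j - ⟪b i, x⟫ • b i := by
    intro i j
    by_cases hij : i = j
    · subst hij
      simp only [infinitesimalRotation_apply, sub_self, inner_zero_right, zero_smul, if_true]
      module
    · simp [infinitesimalRotation_apply, inner_sub_right, real_inner_smul_right, hij, Ne.symm hij,
        b.inner_eq_ite]
  simp only [hterm, Finset.sum_sub_distrib, Finset.sum_ite_eq, Finset.mem_univ, if_true,
    Finset.sum_const, Finset.card_univ, ← Finset.smul_sum, b.sum_repr']
  rw [← Nat.cast_smul_eq_nsmul ℝ]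
  module

lemma sum_sum_bilin_infinitesimalRotation (T : E →L[ℝ] E →L[ℝ] G) (x : E) :
    ∑ i, ∑ j, T (infinitesimalRotation (b i) (b j) x) (infinitesimalRotation (b i) (b j) x) =
      (2 : ℝ) • (‖x‖ ^ 2 • ∑ i, T (b i) (b i) - T x x) := by
  have hterm : ∀ i j,
      T (infinitesimalRotation (b i) (b j) x) (infinitesimalRotation (b i) (b j) x) =
        ⟪b i, x⟫ ^ 2 • T (b j) (b j) - (⟪b j, x⟫ * ⟪b i, x⟫) • T (b j) (b i)
          - (⟪b i, x⟫ * ⟪b j, x⟫) • T (b i) (b j) + ⟪b j, x⟫ ^ 2 • T (b i) (b i) := by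
    intro i j
    simp only [infinitesimalRotation_apply, map_sub, map_smul, sub_apply, smul_apply]
    module
  have hdiag : ∑ i, ∑ j, ⟪b i, x⟫ ^ 2 • T (b j) (b j) = ‖x‖ ^ 2 • ∑ i, T (b i) (b i) := by
    rw [← b.sum_sq_inner_right, Finset.sum_smul_sum]
  have hoff : ∑ i, ∑ j, (⟪b i, x⟫ * ⟪b j, x⟫) • T (b i) (b j) = T x x := by
    conv_rhs => rw [← b.sum_repr' x]
    simp only [map_sum, map_smul, sum_apply, smul_apply, Finset.smul_sum, mul_smul]
    rw [Finset.sum_comm]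
    refine Finset.sum_congr rfl fun i _ => Finset.sum_congr rfl fun j _ => smul_comm _ _ _
  have hdiag' := Finset.sum_comm.trans hdiag
  have hoff' := Finset.sum_comm.trans hoff
  simp only [hterm, Finset.sum_add_distrib, Finset.sum_sub_distrib, hdiag, hoff, hdiag', hoff']
  module

variable [FiniteDimensional ℝ E] {F : E → G}

/-- The Laplace-Beltrami operator of the spheres around the origin, as half the sum of the squares
of the infinitesimal rotations for an orthonormal basis; each rotation occurs for two ordered
pairs of indices. -/
noncomputable def angularLaplacian (F : E → G) (x : E) : G :=
  (2⁻¹ : ℝ) • ∑ i, ∑ j,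
    derivAlong (infinitesimalRotation (stdOrthonormalBasis ℝ E i) (stdOrthonormalBasis ℝ E j))
      (derivAlong (infinitesimalRotation (stdOrthonormalBasis ℝ E i) (stdOrthonormalBasis ℝ E j))
        F) x

lemma laplacian_eq_sum_fderiv_fderiv (F : E → G) (x : E) :
    Δ F x = ∑ i, fderiv ℝ (fderiv ℝ F) x (stdOrthonormalBasis ℝ E i)
      (stdOrthonormalBasis ℝ E i) := by
  rw [InnerProductSpace.laplacian_eq_iteratedFDeriv_stdOrthonormalBasis]
  simp [iteratedFDeriv_two_apply]

lemma contDiffOn_laplacian {s : Set E} (hs : IsOpen s) (hF : ContDiffOn ℝ ∞ F s) :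
    ContDiffOn ℝ ∞ (Δ F) s := by
  have hF'' : ContDiffOn ℝ ∞ (fderiv ℝ (fderiv ℝ F)) s :=
    (hF.fderiv_of_isOpen hs (m := ∞) (by simp)).fderiv_of_isOpen hs (m := ∞) (by simp)
  rw [funext (laplacian_eq_sum_fderiv_fderiv F)]
  exact ContDiffOn.sum fun i _ => (hF''.clm_apply contDiffOn_const).clm_apply contDiffOn_const

lemma angularLaplacian_eq {x : E} (hF : ContDiffAt ℝ ∞ F x) :
    angularLaplacian F x =
      ‖x‖ ^ 2 • Δ F x - derivAlong (.id ℝ E) (derivAlong (.id ℝ E) F) x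
        - (Module.finrank ℝ E - 2 : ℝ) • derivAlong (.id ℝ E) F x := by
  simp only [angularLaplacian, derivAlong_derivAlong hF, Finset.sum_add_distrib,
    sum_sum_bilin_infinitesimalRotation, ← map_sum,
    sum_sum_infinitesimalRotation_infinitesimalRotation, ← laplacian_eq_sum_fderiv_fderiv]
  simp only [derivAlong, map_smul, ContinuousLinearMap.id_apply, Fintype.card_fin]
  module

end AngularLaplacian

section AngularSymmetry

variable {E : Type*} [NormedAddCommGroup E] [InnerProductSpace ℝ E] [FiniteDimensional ℝ E]
  [MeasurableSpace E] [BorelSpace E]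

lemma integral_angularLaplacian_mul {s : Set E} (hs : IsOpen s) {F Q : E → ℂ}
    (hF : ContDiffOn ℝ ∞ F s) (hQ : ContDiffOn ℝ ∞ Q s) {r : ℝ}
    (hr : ∀ θ : Metric.sphere (0 : E) 1, r • θ.1 ∈ s) :
    ∫ θ, angularLaplacian F (r • θ.1) * Q (r • θ.1) ∂(volume : Measure E).toSphere =
      ∫ θ, F (r • θ.1) * angularLaplacian Q (r • θ.1) ∂(volume : Measure E).toSphere := by
  have hint : ∀ {H : E → ℂ}, ContDiffOn ℝ ∞ H s →
      Integrable (fun θ => H (r • θ.1)) (volume : Measure E).toSphere := fun hH =>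
    integrable_toSphere_of_continuous (continuous_comp_smul_sphere hH.continuousOn hr)
  have hF'' := fun B => contDiffOn_derivAlong hs (contDiffOn_derivAlong hs hF B) B
  have hQ'' := fun B => contDiffOn_derivAlong hs (contDiffOn_derivAlong hs hQ B) B
  simp only [angularLaplacian, smul_mul_assoc, mul_smul_comm, integral_smul, Finset.sum_mul,
    Finset.mul_sum]
  congr 1
  rw [integral_finsetSum _ fun i _ => integrable_finsetSum _ fun j _ => hint ((hF'' _).mul hQ),
    integral_finsetSum _ fun i _ => integrable_finsetSum _ fun j _ => hint (hF.mul (hQ'' _))]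
  refine Finset.sum_congr rfl fun i _ => ?_
  rw [integral_finsetSum _ fun j _ => hint ((hF'' _).mul hQ),
    integral_finsetSum _ fun j _ => hint (hF.mul (hQ'' _))]
  exact Finset.sum_congr rfl fun j _ =>
    integral_derivAlong_derivAlong_mul hs hF hQ hr (infinitesimalRotation_mem_skewAdjoint _ _)

end AngularSymmetry

section SolidHarmonic

variable {E : Type*} [NormedAddCommGroup E] [InnerProductSpace ℝ E] [FiniteDimensional ℝ E]

/-- A solid harmonic of degree `k`: a smooth harmonic function that is homogeneous of degree `k`. -/
structure IsSolidHarmonic (k : ℕ) (Q : E → ℂ) : Prop where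
  contDiff : ContDiff ℝ ∞ Q
  laplacian_eq_zero : ∀ x, Δ Q x = 0
  map_smul : ∀ (t : ℝ) (x : E), Q (t • x) = (t : ℂ) ^ k * Q x

namespace IsSolidHarmonic

variable {k : ℕ} {Q : E → ℂ}

lemma conjugate (hQ : IsSolidHarmonic k Q) : IsSolidHarmonic k fun x => conj (Q x) where
  contDiff := Complex.conjCLE.contDiff.comp hQ.contDiff
  laplacian_eq_zero x := by
    have hconj : Δ (fun x => conj (Q x)) x = conj (Δ Q x) :=
      congrFun (InnerProductSpace.laplacian_CLE_comp_left (l := Complex.conjCLE)) x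
    rw [hconj, hQ.laplacian_eq_zero, map_zero]
  map_smul t x := by simp [hQ.map_smul]

lemma derivAlong_id (hQ : IsSolidHarmonic k Q) :
    derivAlong (.id ℝ E) Q = fun x => (k : ℂ) * Q x := by
  ext x
  have hcurve : HasDerivAt (fun t : ℝ => Q (t • x)) (derivAlong (.id ℝ E) Q x) 1 := by
    have hQx : HasFDerivAt Q (fderiv ℝ Q x) ((1 : ℝ) • x) := by
      rw [one_smul]
      exact (hQ.contDiff.differentiable (by simp) x).hasFDerivAt
    simpa [derivAlong, Function.comp_def] using
      hQx.comp_hasDerivAt 1 ((hasDerivAt_id (1 : ℝ)).smul_const x)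
  have hpow : HasDerivAt (fun t : ℝ => Q (t • x)) ((k : ℂ) * Q x) 1 := by
    simp only [hQ.map_smul]
    simpa using ((hasDerivAt_id (1 : ℝ)).ofReal_comp.pow k).mul_const (Q x)
  exact hcurve.unique hpow

lemma angularLaplacian_eq (hQ : IsSolidHarmonic k Q) (x : E) :
    angularLaplacian Q x = -(k * (k + Module.finrank ℝ E - 2)) * Q x := by
  have hQx : DifferentiableAt ℝ Q x := hQ.contDiff.differentiable (by simp) x
  have hEuler : derivAlong (.id ℝ E) (fun x => (k : ℂ) * Q x) x = k * (k * Q x) := by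
    rw [← congrFun hQ.derivAlong_id x, derivAlong, fderiv_const_mul hQx]
    rfl
  rw [_root_.angularLaplacian_eq hQ.contDiff.contDiffAt, hQ.laplacian_eq_zero, hQ.derivAlong_id,
    hEuler, smul_zero, Complex.real_smul]
  push_cast
  ring

end IsSolidHarmonic

end SolidHarmonic

section SphereCoeff

lemma norm_smul_sphere {E : Type*} [NormedAddCommGroup E] [NormedSpace ℝ E] {r : ℝ} (hr : 0 ≤ r)
    (θ : Metric.sphere (0 : E) 1) : ‖r • θ.1‖ = r := by
  rw [norm_smul, norm_eq_of_mem_sphere, mul_one, Real.norm_of_nonneg hr]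

variable {E : Type*} [NormedAddCommGroup E] [InnerProductSpace ℝ E] [FiniteDimensional ℝ E]
  [MeasurableSpace E] [BorelSpace E] {s : Set E} {F Q : E → ℂ} {k : ℕ} {r : ℝ}

/-- The coefficient `r ↦ ∫ F(rθ) Q(θ) dθ` of `F` with respect to a function `Q` on the sphere;
unlike in the Fourier-Laplace coefficients, `Q` is not conjugated. -/
noncomputable def sphereCoeff (F Q : E → ℂ) (r : ℝ) : ℂ :=
  ∫ θ, F (r • θ.1) * Q θ.1 ∂(volume : Measure E).toSphere

lemma norm_sphereCoeff_le {M D : ℝ} (hM : 0 ≤ M)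
    (hF : ∀ θ : Metric.sphere (0 : E) 1, ‖F (r • θ.1)‖ ≤ M)
    (hQ : ∀ θ : Metric.sphere (0 : E) 1, ‖Q θ.1‖ ≤ D) :
    ‖sphereCoeff F Q r‖ ≤ M * D * (volume : Measure E).toSphere.real univ :=
  norm_integral_le_of_norm_le_const (ae_of_all _ fun θ => (norm_mul_le _ _).trans
    (mul_le_mul (hF θ) (hQ θ) (norm_nonneg _) hM))

lemma hasDerivAt_sphereCoeff (hs : IsOpen s) (hF : ContDiffOn ℝ ∞ F s) {I : Set ℝ}
    (hI : IsOpen I) (hIs : ∀ r ∈ I, ∀ θ : Metric.sphere (0 : E) 1, r • θ.1 ∈ s)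
    (hQ : Continuous Q) (hr : r ∈ I) (hr0 : r ≠ 0) :
    HasDerivAt (sphereCoeff F Q) ((r : ℂ)⁻¹ * sphereCoeff (derivAlong (.id ℝ E) F) Q r) r := by
  have hmaps : MapsTo (fun p : ℝ × Metric.sphere (0 : E) 1 => p.1 • p.2.1) (I ×ˢ univ) s :=
    fun p hp => hIs _ hp.1 _
  have hw : Continuous fun p : ℝ × Metric.sphere (0 : E) 1 => Q p.2 := by fun_prop
  have hF' : ContinuousOn (fderiv ℝ F) s :=
    (hF.fderiv_of_isOpen hs (m := ∞) (by simp)).continuousOn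
  have hint := hasDerivAt_integral_of_continuousOn (μ := (volume : Measure E).toSphere) (s := I)
    (Φ := fun t θ => F (t • θ.1) * Q θ.1) (Φ' := fun t θ => fderiv ℝ F (t • θ.1) θ.1 * Q θ.1) hI
    ((hF.continuousOn.comp (by fun_prop) hmaps).mul hw.continuousOn)
    (((hF'.comp (by fun_prop) hmaps).clm_apply (by fun_prop)).mul hw.continuousOn)
    (fun t ht θ => ?_) hr
  · refine hint.congr_deriv ?_
    rw [sphereCoeff, ← integral_const_mul]
    congr 1 with θ
    have hr0' : (r : ℂ) ≠ 0 := by exact_mod_cast hr0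
    simp only [derivAlong, ContinuousLinearMap.id_apply, map_smul, Complex.real_smul]
    field_simp
  · have hFt : HasFDerivAt F (fderiv ℝ F (t • θ.1)) (t • θ.1) :=
      ((hF.contDiffAt (hs.mem_nhds (hIs t ht θ))).differentiableAt (by simp)).hasFDerivAt
    simpa using (hFt.comp_hasDerivAt t ((hasDerivAt_id t).smul_const θ.1)).mul_const (Q θ.1)

lemma sphereCoeff_angularLaplacian (hs : IsOpen s) (hF : ContDiffOn ℝ ∞ F s)
    (hQ : IsSolidHarmonic k Q) (hr0 : r ≠ 0)
    (hr : ∀ θ : Metric.sphere (0 : E) 1, r • θ.1 ∈ s) :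
    sphereCoeff (angularLaplacian F) Q r =
      -(k * (k + Module.finrank ℝ E - 2)) * sphereCoeff F Q r := by
  have hrk : (r : ℂ) ^ k ≠ 0 := pow_ne_zero _ (by exact_mod_cast hr0)
  have hsymm := integral_angularLaplacian_mul hs hF hQ.contDiff.contDiffOn hr
  have hright : ∀ c : ℂ, ∀ θ : Metric.sphere (0 : E) 1,
      F (r • θ.1) * (c * ((r : ℂ) ^ k * Q θ.1)) = (r : ℂ) ^ k * (c * (F (r • θ.1) * Q θ.1)) :=
    fun c θ => by ring
  simp only [hQ.angularLaplacian_eq, hQ.map_smul, hright, mul_left_comm (angularLaplacian F _),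
    integral_const_mul] at hsymm
  exact mul_left_cancel₀ hrk hsymm

lemma sphereCoeff_derivAlong_id_derivAlong_id (hs : IsOpen s) (hF : ContDiffOn ℝ ∞ F s)
    (hQ : IsSolidHarmonic k Q) (hr0 : 0 < r)
    (hr : ∀ θ : Metric.sphere (0 : E) 1, r • θ.1 ∈ s) :
    sphereCoeff (derivAlong (.id ℝ E) (derivAlong (.id ℝ E) F)) Q r =
      (r : ℂ) ^ 2 * sphereCoeff (Δ F) Q r
        - (Module.finrank ℝ E - 2) * sphereCoeff (derivAlong (.id ℝ E) F) Q r
        + k * (k + Module.finrank ℝ E - 2) * sphereCoeff F Q r := by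
  have hE := contDiffOn_derivAlong hs hF (.id ℝ E)
  have hEE := contDiffOn_derivAlong hs hE (.id ℝ E)
  have hint : ∀ {H : E → ℂ}, ContDiffOn ℝ ∞ H s →
      Integrable (fun θ => H (r • θ.1) * Q θ.1) (volume : Measure E).toSphere := fun hH =>
    integrable_toSphere_of_continuous ((continuous_comp_smul_sphere hH.continuousOn hr).mul
      (hQ.contDiff.continuous.comp continuous_subtype_val))
  have hpolar : ∀ θ : Metric.sphere (0 : E) 1,
      angularLaplacian F (r • θ.1) * Q θ.1 =
        (r : ℂ) ^ 2 * (Δ F (r • θ.1) * Q θ.1)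
          - derivAlong (.id ℝ E) (derivAlong (.id ℝ E) F) (r • θ.1) * Q θ.1
          - (Module.finrank ℝ E - 2) * (derivAlong (.id ℝ E) F (r • θ.1) * Q θ.1) := fun θ => by
    rw [angularLaplacian_eq (hF.contDiffAt (hs.mem_nhds (hr θ))), norm_smul_sphere hr0.le,
      Complex.real_smul, Complex.real_smul]
    push_cast
    ring
  have hang := sphereCoeff_angularLaplacian hs hF hQ hr0.ne' hr
  have hΔ := (hint (contDiffOn_laplacian hs hF)).const_mul ((r : ℂ) ^ 2)
  have hΔE := hΔ.sub (hint hEE)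
  simp only [Pi.sub_def] at hΔE
  rw [sphereCoeff, integral_congr_ae (ae_of_all _ hpolar),
    integral_sub hΔE ((hint hE).const_mul _), integral_sub hΔ (hint hEE),
    integral_const_mul, integral_const_mul] at hang
  simp only [sphereCoeff] at hang ⊢
  linear_combination -hang

end SphereCoeff

section Annulus

lemma isOpen_annulus (E : Type*) [NormedAddCommGroup E] (r₀ r₁ : ℝ≥0∞) :
    IsOpen (annulus E r₀ r₁) :=
  isOpen_Ioo.preimage continuous_enorm

lemma annulus_subset_annulus (E : Type*) [NormedAddCommGroup E] {r₀ r₁ s₁ : ℝ≥0∞} (h : r₁ ≤ s₁) :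
    annulus E r₀ r₁ ⊆ annulus E r₀ s₁ := fun _ hx => ⟨hx.1, hx.2.trans_le h⟩

lemma norm_mem_radii_iff {E : Type*} [NormedAddCommGroup E] {r₀ r₁ : ℝ≥0∞} {x : E} :
    ‖x‖ ∈ radii r₀ r₁ ↔ x ∈ annulus E r₀ r₁ := by
  simp only [radii, annulus, mem_ofPred_eq, ofReal_norm]

lemma smul_sphere_mem_annulus {E : Type*} [NormedAddCommGroup E] [NormedSpace ℝ E] {r₀ r₁ : ℝ≥0∞}
    {r : ℝ} (hr : r ∈ radii r₀ r₁) (θ : Metric.sphere (0 : E) 1) : r • θ.1 ∈ annulus E r₀ r₁ :=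
  norm_mem_radii_iff.1 ((norm_smul_sphere (pos_of_mem_radii hr).le θ).symm ▸ hr)

end Annulus

section RadialEquation

variable {E : Type*} [NormedAddCommGroup E] [InnerProductSpace ℝ E] [FiniteDimensional ℝ E]

lemma contDiffOn_iterate_laplacian {s : Set E} (hs : IsOpen s) {F : E → ℂ}
    (hF : ContDiffOn ℝ ∞ F s) (p : ℕ) :
    ContDiffOn ℝ ∞ ((fun g : E → ℂ => Δ g)^[p] F) s := by
  induction p with
  | zero => exact hF
  | succ p ih => rw [Function.iterate_succ_apply']; exact contDiffOn_laplacian hs ih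

variable [MeasurableSpace E] [BorelSpace E]

/-- With `g p` the coefficient of `Δ^p F`, the radial equation reads
`g (p + 1) = g p'' + (dim E - 1) / r * g p' - k (k + dim E - 2) / r ^ 2 * g p`; multiplying `g p` by
`r ^ (k + dim E - 2)` removes the zeroth order term. -/
lemma isRadialChain_sphereCoeff {e k : ℕ} (hE : Module.finrank ℝ E = 2 * e + 3) {r₀ r₁ : ℝ≥0∞}
    {F Q : E → ℂ} (hF : ContDiffOn ℝ ∞ F (annulus E r₀ r₁)) (hQ : IsSolidHarmonic k Q) :
    IsRadialChain (radii r₀ r₁) (k + e)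
      (fun p r => (r : ℂ) ^ (k + 2 * e + 1) * sphereCoeff ((fun g : E → ℂ => Δ g)^[p] F) Q r)
      (fun p r => ((r : ℂ) ^ k)⁻¹ *
        ((k + 2 * e + 1) * sphereCoeff ((fun g : E → ℂ => Δ g)^[p] F) Q r +
          sphereCoeff (derivAlong (.id ℝ E) ((fun g : E → ℂ => Δ g)^[p] F)) Q r)) := by
  have hs := isOpen_annulus E r₀ r₁
  have hderiv {G : E → ℂ} (hG : ContDiffOn ℝ ∞ G (annulus E r₀ r₁)) {r : ℝ}
      (hr : r ∈ radii r₀ r₁) := hasDerivAt_sphereCoeff hs hG (isOpen_radii r₀ r₁)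
    (fun _ => smul_sphere_mem_annulus) hQ.contDiff.continuous hr (pos_of_mem_radii hr).ne'
  have hne {r : ℝ} (hr : r ∈ radii r₀ r₁) : (r : ℂ) ≠ 0 := mod_cast (pos_of_mem_radii hr).ne'
  have hsmooth := contDiffOn_iterate_laplacian hs hF
  refine ⟨fun p r hr => ?_, fun p r hr => ?_⟩
  · have := hne hr
    refine ((hasDerivAt_ofReal_pow (k + 2 * e) r).mul (hderiv (hsmooth p) hr)).congr_deriv ?_
    push_cast
    field_simp
    ring
  · have := hne hr
    refine ((hasDerivAt_inv_ofReal_pow k (pos_of_mem_radii hr).ne').mul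
      (((hderiv (hsmooth p) hr).const_mul (k + 2 * e + 1 : ℂ)).add
        (hderiv (contDiffOn_derivAlong hs (hsmooth p) (.id ℝ E)) hr))).congr_deriv ?_
    rw [sphereCoeff_derivAlong_id_derivAlong_id hs (hsmooth p) hQ (pos_of_mem_radii hr)
      (smul_sphere_mem_annulus hr), hE, Function.iterate_succ_apply', Pi.add_apply]
    push_cast
    field_simp
    ring

lemma IsPolyharmonicInfiniteOrder.mono {d : ℕ} {G H : Set (EuclideanSpace ℝ (Fin d))} {τ : ℝ}
    {f : EuclideanSpace ℝ (Fin d) → ℂ} (hf : IsPolyharmonicInfiniteOrder H τ f) (hGH : G ⊆ H) :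
    IsPolyharmonicInfiniteOrder G τ f :=
  ⟨hf.1.mono hGH, fun K hK hKG => hf.2 K hK (hKG.trans hGH)⟩

lemma IsPolyharmonicInfiniteOrder.hasGrowthType_sphereCoeff {d : ℕ} {r₀ r₁ : ℝ≥0∞} {τ : ℝ≥0}
    {f Q : EuclideanSpace ℝ (Fin d) → ℂ}
    (hf : IsPolyharmonicInfiniteOrder (annulus (EuclideanSpace ℝ (Fin d)) r₀ r₁) τ f)
    (hQ : Continuous Q) :
    HasGrowthType (radii r₀ r₁) τ fun p =>
      sphereCoeff ((fun g : EuclideanSpace ℝ (Fin d) → ℂ => Δ g)^[p] f) Q := by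
  intro a b hab ε hε
  set K : Set (EuclideanSpace ℝ (Fin d)) := norm ⁻¹' Icc a b
  have hK : IsCompact K := Metric.isCompact_of_isClosed_isBounded
    (isClosed_Icc.preimage continuous_norm)
    (Metric.isBounded_closedBall.subset fun x hx => mem_closedBall_zero_iff.2 hx.2)
  obtain ⟨C, hC, hf⟩ := hf.2 K hK (fun x hx => norm_mem_radii_iff.1 (hab hx)) ε hε
  obtain ⟨D, hD⟩ := (isCompact_sphere (0 : EuclideanSpace ℝ (Fin d)) 1).exists_bound_of_continuousOn
    hQ.continuousOn
  refine ⟨C * max D 0 * (surfaceMeasure d).real univ, by positivity, fun p r hr => ?_⟩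
  refine (norm_sphereCoeff_le (M := C * (2 * p)! * (τ + ε) ^ (2 * p)) (by positivity)
    (fun θ => hf p _ ?_) (fun θ => (hD θ θ.2).trans (le_max_left D 0))).trans_eq (by ring)
  rwa [mem_preimage, norm_smul_sphere (pos_of_mem_radii (hab hr)).le]

lemma IsPolyharmonicInfiniteOrder.hasFrobeniusExpansion {d e k : ℕ} (hd : d = 2 * e + 3)
    {r₀ r₁ : ℝ≥0∞} {τ : ℝ≥0} {f Q : EuclideanSpace ℝ (Fin d) → ℂ}
    (hf : IsPolyharmonicInfiniteOrder (annulus (EuclideanSpace ℝ (Fin d)) r₀ r₁) τ f)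
    (hQ : IsSolidHarmonic k Q) :
    HasFrobeniusExpansion (radii r₀ (min r₁ (1 / (2 * τ)))) (1 / (2 * τ)) (k + e)
      fun r => (r : ℂ) ^ (k + 2 * e + 1) * sphereCoeff f Q r := by
  have hf' := hf.mono (annulus_subset_annulus _ (min_le_left r₁ (1 / (2 * τ))))
  have hgrowth := (hf'.hasGrowthType_sphereCoeff hQ.contDiff.continuous).continuousOn_mul
    (w := fun r : ℝ => (r : ℂ) ^ (k + 2 * e + 1)) (by fun_prop)
  have hchain := isRadialChain_sphereCoeff (by rw [finrank_euclideanSpace_fin, hd]) hf'.1 hQ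
  exact hchain.hasFrobeniusExpansion (isOpen_radii _ _) (ordConnected_radii _ _)
    (fun r hr => ⟨bot_le.trans_lt hr.1, hr.2.trans_le (min_le_right _ _)⟩) hgrowth

end RadialEquation

section HarmonicPolynomial

variable {d : ℕ}

lemma evalReal_C (a : ℂ) : evalReal (MvPolynomial.C a : MvPolynomial (Fin d) ℂ) = fun _ => a := by
  ext
  simp [evalReal]

lemma evalReal_add (p q : MvPolynomial (Fin d) ℂ) :
    evalReal (p + q) = fun x => evalReal p x + evalReal q x := by
  ext
  simp [evalReal]

lemma evalReal_mul_X (p : MvPolynomial (Fin d) ℂ) (j : Fin d) :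
    evalReal (p * MvPolynomial.X j) = fun x => evalReal p x * (x j : ℂ) := by
  ext
  simp [evalReal]

lemma contDiff_evalReal (q : MvPolynomial (Fin d) ℂ) : ContDiff ℝ ∞ (evalReal q) := by
  induction q using MvPolynomial.induction_on with
  | C a => simpa only [evalReal_C] using contDiff_const
  | add p q hp hq => simpa only [evalReal_add] using hp.add hq
  | mul_X p j hp =>
    rw [evalReal_mul_X]
    exact hp.mul (Complex.ofRealCLM ∘L EuclideanSpace.proj (𝕜 := ℝ) j).contDiff

lemma fderiv_evalReal_single (q : MvPolynomial (Fin d) ℂ) (x : EuclideanSpace ℝ (Fin d))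
    (i : Fin d) :
    fderiv ℝ (evalReal q) x (EuclideanSpace.single i 1) =
      evalReal (MvPolynomial.pderiv i q) x := by
  have hdiff (p : MvPolynomial (Fin d) ℂ) : DifferentiableAt ℝ (evalReal p) x :=
    (contDiff_evalReal p).differentiable (by simp) x
  induction q using MvPolynomial.induction_on with
  | C a =>
    rw [evalReal_C, fderiv_const_apply]
    simp [evalReal]
  | add p q hp hq =>
    rw [evalReal_add, fderiv_fun_add (hdiff p) (hdiff q), map_add, evalReal_add, add_apply, hp, hq]
  | mul_X p j hp =>
    have hcoord : HasFDerivAt (fun y : EuclideanSpace ℝ (Fin d) => (y j : ℂ))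
        (Complex.ofRealCLM ∘L EuclideanSpace.proj (𝕜 := ℝ) j) x :=
      (Complex.ofRealCLM ∘L EuclideanSpace.proj (𝕜 := ℝ) j).hasFDerivAt
    rw [evalReal_mul_X, ((hdiff p).hasFDerivAt.fun_mul hcoord).fderiv, add_apply, smul_apply,
      smul_apply, hp]
    simp [evalReal, MvPolynomial.pderiv_X, Pi.single_apply, apply_ite, mul_comm, eq_comm]

lemma laplacian_evalReal (q : MvPolynomial (Fin d) ℂ) (x : EuclideanSpace ℝ (Fin d)) :
    Δ (evalReal q) x = evalReal (polyLaplacian d q) x := by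
  have hsecond (i : Fin d) : fderiv ℝ (fderiv ℝ (evalReal q)) x (EuclideanSpace.single i 1)
      (EuclideanSpace.single i 1) =
        evalReal (MvPolynomial.pderiv i (MvPolynomial.pderiv i q)) x := by
    have hq : DifferentiableAt ℝ (fderiv ℝ (evalReal q)) x :=
      ((contDiff_evalReal q).fderiv_right (m := ∞) (by simp)).differentiable (by simp) x
    rw [← fderiv_evalReal_single, ← funext fun y => fderiv_evalReal_single q y i,
      fderiv_clm_apply hq (differentiableAt_const _)]
    simp
  simp only [InnerProductSpace.laplacian_eq_iteratedFDeriv_orthonormalBasis _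
    (EuclideanSpace.basisFun (Fin d) ℝ), EuclideanSpace.basisFun_apply, iteratedFDeriv_two_apply,
    Matrix.cons_val_zero, Matrix.cons_val_one, hsecond]
  simp [evalReal, polyLaplacian]

lemma evalReal_smul {k : ℕ} {q : MvPolynomial (Fin d) ℂ} (hq : q.IsHomogeneous k) (t : ℝ)
    (x : EuclideanSpace ℝ (Fin d)) : evalReal q (t • x) = (t : ℂ) ^ k * evalReal q x := by
  simp only [evalReal, MvPolynomial.eval_eq', Finset.mul_sum]
  refine Finset.sum_congr rfl fun m hm => ?_
  have hdegree : ∑ i, m i = k := by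
    rw [← Finsupp.degree_eq_sum, Finsupp.degree_eq_weight_one]
    exact hq (MvPolynomial.mem_support_iff.1 hm)
  simp only [PiLp.smul_apply, smul_eq_mul, Complex.ofReal_mul, mul_pow, Finset.prod_mul_distrib,
    Finset.prod_pow_eq_pow_sum, hdegree]
  ring

lemma isSolidHarmonic_evalReal {k : ℕ} {P : MvPolynomial (Fin d) ℂ}
    (hP : P ∈ harmonicHomogeneous d k) : IsSolidHarmonic k (evalReal P) where
  contDiff := contDiff_evalReal P
  laplacian_eq_zero x := by
    rw [laplacian_evalReal, LinearMap.mem_ker.1 hP.2, evalReal, map_zero]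
  map_smul := evalReal_smul hP.1

end HarmonicPolynomial

section LaurentExtension

lemma expo_two_mul (d k j : ℕ) : expo d k (2 * j) = ((k + 2 * j : ℕ) : ℤ) := by
  simp [expo]

lemma expo_two_mul_add_one (d k j : ℕ) :
    expo d k (2 * j + 1) = (-(k : ℤ) - d + 2) + ((2 * j : ℕ) : ℤ) := by
  have hhalf : (2 * j + 1) / 2 = j := by lia
  simp [expo, hhalf, parity_simps]

variable {R : ℝ≥0∞} {d k : ℕ} {a : ℕ → ℂ}

lemma mul_zpow_expo_two_mul (z : ℂ) (j : ℕ) :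
    a (2 * j) * z ^ expo d k (2 * j) = z ^ k * (a (2 * j) * z ^ (2 * j)) := by
  rw [expo_two_mul, zpow_natCast, pow_add, mul_left_comm]

lemma mul_zpow_expo_two_mul_add_one {z : ℂ} (hz : z ≠ 0) (j : ℕ) :
    a (2 * j + 1) * z ^ expo d k (2 * j + 1) =
      z ^ (-(k : ℤ) - d + 2) * (a (2 * j + 1) * z ^ (2 * j)) := by
  rw [expo_two_mul_add_one, zpow_add₀ hz, zpow_natCast, mul_left_comm]

lemma ne_zero_of_mem_annulus {r₀ r₁ : ℝ≥0∞} {z : ℂ} (hz : z ∈ annulus ℂ r₀ r₁) : z ≠ 0 :=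
  enorm_pos.1 (bot_le.trans_lt hz.1)

lemma hasSum_laurentExtension (h₀ : EvenSummableBelow R fun j => a (2 * j))
    (h₁ : EvenSummableBelow R fun j => a (2 * j + 1)) {z : ℂ} (hz : z ∈ annulus ℂ 0 R) :
    HasSum (fun j => a j * z ^ expo d k j) (laurentExtension d k a z) := by
  refine .even_add_odd ?_ ?_
  · simp_rw [mul_zpow_expo_two_mul]
    exact (h₀.summable_norm hz.2).of_norm.hasSum.mul_left _
  · simp_rw [mul_zpow_expo_two_mul_add_one (ne_zero_of_mem_annulus hz)]
    exact (h₁.summable_norm hz.2).of_norm.hasSum.mul_left _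

lemma differentiableOn_laurentExtension (h₀ : EvenSummableBelow R fun j => a (2 * j))
    (h₁ : EvenSummableBelow R fun j => a (2 * j + 1)) :
    DifferentiableOn ℂ (laurentExtension d k a) (annulus ℂ 0 R) := fun _ hz =>
  (((differentiableAt_pow k).mul (h₀.differentiableAt_evenSum hz.2)).add
    ((differentiableAt_zpow.2 (.inl (ne_zero_of_mem_annulus hz))).mul
      (h₁.differentiableAt_evenSum hz.2))).differentiableWithinAt

lemma exists_summable_bound_laurentExtension (h₀ : EvenSummableBelow R fun j => a (2 * j))
    (h₁ : EvenSummableBelow R fun j => a (2 * j + 1)) {K : Set ℂ} (hK : IsCompact K)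
    (hKR : K ⊆ annulus ℂ 0 R) :
    ∃ u : ℕ → ℝ, Summable u ∧ ∀ j, ∀ z ∈ K, ‖a j * z ^ expo d k j‖ ≤ u j := by
  rcases K.eq_empty_or_nonempty with rfl | hne
  · exact ⟨0, summable_zero, by simp⟩
  obtain ⟨w, hwK, hmax⟩ := hK.exists_isMaxOn hne continuous_norm.continuousOn
  have hw (z : ℂ) (hz : z ∈ K) : ‖z‖ ≤ ‖w‖ := hmax hz
  obtain ⟨C, hC⟩ := hK.exists_bound_of_continuousOn
    (f := fun z => z ^ (-(k : ℤ) - d + 2)) fun z hz =>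
      (continuousAt_zpow₀ z _ (.inl (ne_zero_of_mem_annulus (hKR hz)))).continuousWithinAt
  refine ⟨interleave (fun j => ‖w‖ ^ k * (‖a (2 * j)‖ * ‖w‖ ^ (2 * j)))
    (fun j => C * (‖a (2 * j + 1)‖ * ‖w‖ ^ (2 * j))),
    (HasSum.even_add_odd (Summable.hasSum ?_) (Summable.hasSum ?_)).summable, fun n z hz => ?_⟩
  · simpa only [interleave_two_mul, coe_nnnorm] using (h₀ ‖w‖₊ (hKR hwK).2).mul_left (‖w‖ ^ k)
  · simpa only [interleave_two_mul_add_one, coe_nnnorm] using (h₁ ‖w‖₊ (hKR hwK).2).mul_left C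
  rcases n.even_or_odd' with ⟨j, rfl | rfl⟩
  · rw [mul_zpow_expo_two_mul, norm_mul, norm_pow, interleave_two_mul]
    gcongr
    exacts [hw z hz, norm_mul_pow_two_mul_le _ (hw z hz) j]
  · rw [mul_zpow_expo_two_mul_add_one (ne_zero_of_mem_annulus (hKR hz)), norm_mul,
      interleave_two_mul_add_one]
    have hC0 : 0 ≤ C := (norm_nonneg _).trans (hC z hz)
    gcongr
    exacts [hC z hz, norm_mul_pow_two_mul_le _ (hw z hz) j]

lemma hasSumUniformlyOn_laurentExtension (h₀ : EvenSummableBelow R fun j => a (2 * j))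
    (h₁ : EvenSummableBelow R fun j => a (2 * j + 1)) {K : Set ℂ} (hK : IsCompact K)
    (hKR : K ⊆ annulus ℂ 0 R) :
    HasSumUniformlyOn (fun j z => a j * z ^ expo d k j) (laurentExtension d k a) K ∧
      SummableUniformlyOn (fun j z => ‖a j * z ^ expo d k j‖) K := by
  obtain ⟨u, hu, hbound⟩ := exists_summable_bound_laurentExtension (d := d) (k := k) h₀ h₁ hK hKR
  exact ⟨(HasSumUniformlyOn.of_norm_le_summable hu hbound).congr_right fun z hz =>
      (hasSum_laurentExtension h₀ h₁ (hKR hz)).tsum_eq,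
    (HasSumUniformlyOn.of_norm_le_summable hu fun j z hz => by
      simpa only [norm_norm] using hbound j z hz).summableUniformlyOn⟩

lemma pow_mul_laurentExtension_interleave {e : ℕ} (hd : d = 2 * e + 3) (b c : ℕ → ℂ) {z : ℂ}
    (hz : z ≠ 0) :
    z ^ (k + 2 * e + 1) * laurentExtension d k (interleave b c) z =
      z ^ (2 * (k + e) + 1) * evenSum b z + evenSum c z := by
  have heven : evenPart (interleave b c) = evenSum b := by
    simp only [funext_iff, evenPart, interleave_two_mul, evenSum, implies_true]
  have hodd : oddPart (interleave b c) = evenSum c := by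
    simp only [funext_iff, oddPart, interleave_two_mul_add_one, evenSum, implies_true]
  have hexp : -(k : ℤ) - d + 2 = -((k + 2 * e + 1 : ℕ) : ℤ) := by lia
  rw [laurentExtension, heven, hodd, hexp, zpow_neg, zpow_natCast, mul_add,
    mul_inv_cancel_left₀ (pow_ne_zero _ hz)]
  ring

end LaurentExtension

theorem mainTheorem2_general (d : ℕ) (hd : 1 < d) (hodd : Odd d)
    (r₀ : ℝ≥0) (r₁ : ℝ≥0∞) (τ : ℝ≥0)
    (f : EuclideanSpace ℝ (Fin d) → ℂ)
    (hf : IsPolyharmonicInfiniteOrder (annulus (EuclideanSpace ℝ (Fin d)) r₀ r₁) τ f)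
    (k : ℕ) (P : MvPolynomial (Fin d) ℂ) (hP : P ∈ harmonicHomogeneous d k) :
    ∃ a : ℕ → ℂ,
      (∀ r : ℝ≥0, r₀ < r → (r : ℝ≥0∞) < r₁ → (r : ℝ≥0∞) < 1 / (2 * (τ : ℝ≥0∞)) →
        fourierLaplaceCoeff f P r = laurentExtension d k a ((r : ℝ) : ℂ)) ∧
      DifferentiableOn ℂ (laurentExtension d k a) (annulus ℂ 0 (1 / (2 * (τ : ℝ≥0∞)))) ∧
      (∀ z ∈ annulus ℂ 0 (1 / (2 * (τ : ℝ≥0∞))), Summable fun j => ‖a j * z ^ expo d k j‖) ∧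
      (∀ K : Set ℂ, IsCompact K → K ⊆ annulus ℂ 0 (1 / (2 * (τ : ℝ≥0∞))) →
        HasSumUniformlyOn (fun j z => a j * z ^ expo d k j) (laurentExtension d k a) K ∧
        SummableUniformlyOn (fun j z => ‖a j * z ^ expo d k j‖) K) ∧
      1 / (2 * (τ : ℝ≥0∞)) ≤ (evenSeries a).radius ∧
      1 / (2 * (τ : ℝ≥0∞)) ≤ (oddSeries a).radius ∧
      (τ = 0 → Differentiable ℂ (evenPart a) ∧ Differentiable ℂ (oddPart a)) := by
  obtain ⟨e, he⟩ : ∃ e, d = 2 * e + 3 := by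
    obtain ⟨m, hm⟩ := hodd
    exact ⟨m - 1, by lia⟩
  obtain ⟨b, c, hb, hc, hexpansion⟩ :=
    hf.hasFrobeniusExpansion he (isSolidHarmonic_evalReal hP).conjugate
  have h₀ : EvenSummableBelow (1 / (2 * τ)) fun j => interleave b c (2 * j) := by
    simpa only [interleave_two_mul] using hb
  have h₁ : EvenSummableBelow (1 / (2 * τ)) fun j => interleave b c (2 * j + 1) := by
    simpa only [interleave_two_mul_add_one] using hc
  refine ⟨interleave b c, fun r hr₀ hr₁ hrτ => ?_, differentiableOn_laurentExtension h₀ h₁,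
    fun z hz => (hasSum_laurentExtension h₀ h₁ hz).summable.norm,
    fun K hK hKR => hasSumUniformlyOn_laurentExtension h₀ h₁ hK hKR, h₀.le_radius,
    h₁.le_radius (a := fun n => interleave b c (n + 1)), fun hτ => ?_⟩
  · have hr : (r : ℝ) ∈ radii r₀ (min r₁ (1 / (2 * τ))) := by
      simpa [radii] using ⟨hr₀, hr₁, by simpa using hrτ⟩
    have hr0 : ((r : ℝ) : ℂ) ≠ 0 := mod_cast (pos_of_mem_radii hr).ne'
    refine mul_left_cancel₀ (pow_ne_zero (k + 2 * e + 1) hr0) ?_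
    rw [pow_mul_laurentExtension_interleave he b c hr0]
    exact hexpansion r hr
  · subst hτ
    exact ⟨fun z => h₀.differentiableAt_evenSum (by simp),
      fun z => h₁.differentiableAt_evenSum (by simp)⟩

theorem mainTheorem2 (d : ℕ) (hd : 1 < d) (hodd : Odd d)
    (Y : ∀ k : ℕ, Module.Basis (Fin (harmonicDim d k)) ℂ (harmonicHomogeneous d k))
    (hY : IsSphereOrthonormal Y)
    (r₀ : ℝ≥0) (r₁ : ℝ≥0∞) (hr : (r₀ : ℝ≥0∞) < r₁)
    (τ : ℝ≥0) (hτ : (τ : ℝ≥0∞) < 1 / (2 * (r₀ : ℝ≥0∞)))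
    (f : EuclideanSpace ℝ (Fin d) → ℂ)
    (hf : IsPolyharmonicInfiniteOrder (annulus (EuclideanSpace ℝ (Fin d)) r₀ r₁) τ f)
    (k : ℕ) (l : Fin (harmonicDim d k)) :
    ∃ a : ℕ → ℂ,
      -- the representation of the coefficient on the part of `(r₀, r₁)` below `1 / (2τ)`
      (∀ r : ℝ≥0, r₀ < r → (r : ℝ≥0∞) < r₁ → (r : ℝ≥0∞) < 1 / (2 * (τ : ℝ≥0∞)) →
        fourierLaplaceCoeff f (Y k l) r = laurentExtension d k a ((r : ℝ) : ℂ)) ∧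
      -- the right-hand side is an analytic extension to `0 < |z| < 1 / (2τ)`
      DifferentiableOn ℂ (laurentExtension d k a) (annulus ℂ 0 (1 / (2 * (τ : ℝ≥0∞)))) ∧
      -- absolute and compact convergence there
      (∀ z ∈ annulus ℂ 0 (1 / (2 * (τ : ℝ≥0∞))), Summable fun j => ‖a j * z ^ expo d k j‖) ∧
      (∀ K : Set ℂ, IsCompact K → K ⊆ annulus ℂ 0 (1 / (2 * (τ : ℝ≥0∞))) →
        HasSumUniformlyOn (fun j z => a j * z ^ expo d k j) (laurentExtension d k a) K ∧
        SummableUniformlyOn (fun j z => ‖a j * z ^ expo d k j‖) K) ∧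
      -- the radii of convergence of the two power series
      1 / (2 * (τ : ℝ≥0∞)) ≤ (evenSeries a).radius ∧
      1 / (2 * (τ : ℝ≥0∞)) ≤ (oddSeries a).radius ∧
      (τ = 0 → Differentiable ℂ (evenPart a) ∧ Differentiable ℂ (oddPart a)) :=
  mainTheorem2_general d hd hodd r₀ r₁ τ f hf k _ (Y k l).2
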